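/- Let $k\ge 0$ be an integer and let $(G_i,X_i)$, $i=0,1,2,\dots$, be a sequence of groups $G_i$ acting faithfully and transitively on finite sets $X_i$. For every $i$ let $a_{i,1},\dots,a_{i,k}$ be elements generating $G_i$, and let $x_i\neq y_i$ be two distinct points of $X_i$. For $i\ge 0$ let $T_i=\bigsqcup_{n\ge 0}X_i\times X_{i+1}\times\cdots\times X_{i+n-1}$ be the rooted tree of finite words over the sequence of alphabets $X_i,X_{i+1},\dots$ (the root is the empty word, and a word $v$ is joined by an edge to each word $ve$ obtained by appending one letter $e$ to $v$). Define automorphisms $\alpha_{i,j},\beta_{i,j}$ ($1\le j\le k$) of the rooted tree $T_i$ by fixing the empty word and by the recurrent rules, for $x\in X_i$ and $w\in T_{i+1}$, \[\alpha_{i,j}(xw)=a_{i,j}(x)\,w,\qquad \beta_{i,j}(xw)=\begin{cases}x_i\,\beta_{i+1,j}(w) & \text{if } x=x_i,\\ y_i\,\alpha_{i+1,j}(w) & \text{if } x=y_i,\\ xw & \text{otherwise.}\end{cases}\] Then the group $G=\langle\alpha_{0,1},\dots,\alpha_{0,k},\beta_{0,1},\dots,\beta_{0,k}\rangle$ is amenable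 if and only if the subgroup of $\prod_{i=1}^\infty G_i$ generated by the sequences $(a_{1,j},a_{2,j},\dots)$, $j=1,\dots,k$, is amenable. In particular, if all the groups $G_i$ are cyclic (of arbitrary, possibly varying orders), then $G$ is amenable. Here a group $H$ is amenable if there is a finitely additive map $\mu$ from the set of all subsets of $H$ to $[0,1]$ with $\mu(H)=1$ and $\mu(hA)=\mu(A)$ for all $h\in H$, $A\subseteq H$. -/

import Mathlib

namespace SegalType

universe u v

/-! ### Amenability -/

/-- `μ` is an invariant mean for the action of `G` on `S`: a finitely additive, `G`-invariant map
from the set of all subsets of `S` to `[0, 1]` of total mass `1`. -/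
structure IsInvariantMean (G : Type*) (S : Type*) [Group G] [MulAction G S]
    (μ : Set S → ℝ) : Prop where
  mem_Icc : ∀ A : Set S, μ A ∈ Set.Icc (0 : ℝ) 1
  univ_eq_one : μ Set.univ = 1
  additive : ∀ A B : Set S, Disjoint A B → μ (A ∪ B) = μ A + μ B
  invariant : ∀ (g : G) (A : Set S), μ ((fun s => g • s) '' A) = μ A

/-- An action is amenable if it has an invariant mean. -/
def IsAmenableAction (G : Type*) (S : Type*) [Group G] [MulAction G S] : Prop :=
  ∃ μ : Set S → ℝ, IsInvariantMean G S μ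

/-- A (discrete) group is amenable if its action on itself by left multiplication is amenable. -/
def IsAmenableGroup (G : Type*) [Group G] : Prop :=
  IsAmenableAction G G

/-! ### The rooted trees of finite words -/

/-- `Word X i` is the set of finite words over the sequence of alphabets `X i, X (i + 1), …`,
i.e. the disjoint union over `n` of `X i × ⋯ × X (i + n - 1)`. -/
inductive Word (X : ℕ → Type u) : ℕ → Type u
  | nil {i : ℕ} : Word X i
  | cons {i : ℕ} (x : X i) (w : Word X (i + 1)) : Word X i

/-- `IsChild v w` means that `w` is obtained from `v` by appending one letter at the end of `v`.
These are the edges, directed away from the root (the empty word), of the rooted tree of words. -/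
inductive IsChild {X : ℕ → Type u} : ∀ {i : ℕ}, Word X i → Word X i → Prop
  | root {i : ℕ} (e : X i) : IsChild Word.nil (Word.cons e Word.nil)
  | cons {i : ℕ} (x : X i) {v w : Word X (i + 1)} (h : IsChild v w) :
      IsChild (Word.cons x v) (Word.cons x w)

/-- The automorphism group of the rooted tree `Word X i`: bijections of the vertices preserving
the parent–child relation in both directions, with composition as multiplication. -/
abbrev TreeAut (X : ℕ → Type u) (i : ℕ) : Type u :=
  (IsChild (X := X) (i := i)) ≃r (IsChild (X := X) (i := i))

theorem exists_isChild {X : ℕ → Type u} {i : ℕ} (w : Word X i) :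
    w ≠ Word.nil → ∃ v, IsChild v w := by
  induction w with
  | nil => exact fun h => absurd rfl h
  | cons x w ih =>
    intro _
    cases w with
    | nil => exact ⟨_, IsChild.root x⟩
    | cons y w =>
      obtain ⟨v, hv⟩ := ih (by simp)
      exact ⟨_, IsChild.cons x hv⟩

theorem not_isChild_nil {X : ℕ → Type u} {i : ℕ} (v : Word X i) : ¬ IsChild v Word.nil :=
  fun h => nomatch h

/-- Tree automorphisms fix the root. -/
theorem TreeAut.map_nil {X : ℕ → Type u} {i : ℕ} (f : TreeAut X i) : f Word.nil = Word.nil := by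
  by_contra h
  obtain ⟨v, hv⟩ := exists_isChild _ h
  rw [← f.apply_symm_apply v, f.map_rel_iff] at hv
  exact not_isChild_nil _ hv

/-! ### The automorphisms `α` and `β`

Here `b = (b i)` is a sequence of elements of the groups `G i` and `x i, y i` are the
distinguished letters. -/

section Generators

variable {X : ℕ → Type u} {G : ℕ → Type v} [∀ i, Group (G i)] [∀ i, MulAction (G i) (X i)]

/-- `α_i (x w) = b_i(x) w`. -/
def alphaFun (b : ∀ i, G i) : ∀ {i : ℕ}, Word X i → Word X i
  | _, Word.nil => Word.nil
  | i, Word.cons z w => Word.cons (b i • z) w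

open Classical in
/-- `β_i (x_i w) = x_i β_{i+1}(w)`, `β_i (y_i w) = y_i α_{i+1}(w)`, and `β_i (z w) = z w` for all
other letters `z`. -/
noncomputable def betaFun (b : ∀ i, G i) (x y : ∀ i, X i) : ∀ {i : ℕ}, Word X i → Word X i
  | _, Word.nil => Word.nil
  | i, Word.cons z w =>
      if z = x i then Word.cons z (betaFun b x y w)
      else if z = y i then Word.cons z (alphaFun b w)
      else Word.cons z w

theorem alphaFun_inv (b c : ∀ i, G i) (h : ∀ i, b i * c i = 1) {i : ℕ} (w : Word X i) :
    alphaFun b (alphaFun c w) = w := by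
  cases w with
  | nil => rfl
  | cons z w => simp [alphaFun, smul_smul, h]

theorem betaFun_inv (b c : ∀ i, G i) (h : ∀ i, b i * c i = 1) (x y : ∀ i, X i) {i : ℕ}
    (w : Word X i) : betaFun b x y (betaFun c x y w) = w := by
  induction w with
  | nil => rfl
  | @cons i z w ih =>
    by_cases hx : z = x i
    · simp [betaFun, hx, ih]
    · by_cases hy : z = y i
      · have hyx : ¬ y i = x i := hy ▸ hx
        simp [betaFun, hy, hyx, alphaFun_inv b c h]
      · simp [betaFun, hx, hy]

theorem isChild_alphaFun (b : ∀ i, G i) {i : ℕ} {v w : Word X i} (h : IsChild v w) :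
    IsChild (alphaFun b v) (alphaFun b w) := by
  cases h with
  | root e => exact IsChild.root _
  | cons z h => exact IsChild.cons _ h

theorem isChild_betaFun (b : ∀ i, G i) (x y : ∀ i, X i) {i : ℕ} {v w : Word X i}
    (h : IsChild v w) : IsChild (betaFun b x y v) (betaFun b x y w) := by
  induction h with
  | @root i e =>
    by_cases hx : e = x i
    · simpa [betaFun, hx] using IsChild.root (x i)
    · by_cases hy : e = y i
      · have hyx : ¬ y i = x i := hy ▸ hx
        simpa [betaFun, hy, hyx, alphaFun] using IsChild.root (y i)
      · simpa [betaFun, hx, hy] using IsChild.root e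
  | @cons i z v w h ih =>
    by_cases hx : z = x i
    · simpa [betaFun, hx] using IsChild.cons (x i) ih
    · by_cases hy : z = y i
      · have hyx : ¬ y i = x i := hy ▸ hx
        simpa [betaFun, hy, hyx] using IsChild.cons (y i) (isChild_alphaFun b h)
      · simpa [betaFun, hx, hy] using IsChild.cons z h

/-- The tree automorphism with underlying map `alphaFun b` on words over `X i, X (i + 1), …`. -/
def alpha (b : ∀ i, G i) (i : ℕ) : TreeAut X i where
  toFun := alphaFun b
  invFun := alphaFun b⁻¹
  left_inv := alphaFun_inv _ _ (by simp)
  right_inv := alphaFun_inv _ _ (by simp)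
  map_rel_iff' := by
    intro v w
    refine ⟨fun h => ?_, fun h => isChild_alphaFun b h⟩
    have := isChild_alphaFun b⁻¹ h
    simpa [alphaFun_inv b⁻¹ b (by simp)] using this

/-- The tree automorphism with underlying map `betaFun b x y` on words over
`X i, X (i + 1), …`. -/
noncomputable def beta (b : ∀ i, G i) (x y : ∀ i, X i) (i : ℕ) : TreeAut X i where
  toFun := betaFun b x y
  invFun := betaFun b⁻¹ x y
  left_inv := betaFun_inv _ _ (by simp) x y
  right_inv := betaFun_inv _ _ (by simp) x y
  map_rel_iff' := by
    intro v w
    refine ⟨fun h => ?_, fun h => isChild_betaFun b x y h⟩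
    have := isChild_betaFun b⁻¹ x y h
    simpa [betaFun_inv b⁻¹ b (by simp) x y] using this

/-- The group `⟨α_{0,1}, …, α_{0,k}, β_{0,1}, …, β_{0,k}⟩`, where `α_{0,j}, β_{0,j}` are defined by
the sequence `i ↦ a i j`. -/
noncomputable def segalGroup {k : ℕ} (a : ∀ i, Fin k → G i) (x y : ∀ i, X i) :
    Subgroup (TreeAut X 0) :=
  Subgroup.closure
    (Set.range (fun j : Fin k => alpha (X := X) (fun i => a i j) 0) ∪
      Set.range (fun j : Fin k => beta (fun i => a i j) x y 0))

/-- The subgroup of `∏_{i ≥ 1} G_i` generated by the sequences `(a_{1,j}, a_{2,j}, …)`,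
`1 ≤ j ≤ k`. -/
def sequenceGroup {k : ℕ} (a : ∀ i, Fin k → G i) : Subgroup (∀ i : ℕ, G (i + 1)) :=
  Subgroup.closure (Set.range (fun (j : Fin k) (i : ℕ) => a (i + 1) j))

end Generators

end SegalType

namespace SegalType

universe u v

open Filter Topology

/-! ### Finitely additive means -/

/-! The tree is replaced by its boundary, the infinite sequences. The two actions of the generators
agree on prefixes and determine each other, so `segalGroup` is isomorphic to `boundaryGroup`. On the
boundary, the `β` are values of a homomorphism `betaPerm y x`, which embeds `sequenceGroup` in
`boundaryGroup` since the actions are faithful and `x i ≠ y i`. Amenability passes to subgroups,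
which gives one implication.

The converse studies germs, taken modulo changes of finitely many letters. The germs of `α` are all
trivial, and those of `β` are trivial except at `x`. Hence every element of `boundaryGroup` has
trivial germs outside a finite set of points cofinal with `x`, and all its germs come from
`sequenceGroup`. By compactness, an element with only trivial germs changes only the letters before
some fixed level, so these elements form a locally finite, hence amenable, group
(`isAmenableGroup_finitaryPerm`).

The pieces are glued by extensive amenability. The functions `ramp` have finite support, are
eventually maximal at each point cofinal with `x`, and have energy `O(1 / n)` under the generators.
Independent random subsets with inclusion probability `sin²` of these functions converge to an
invariant mean on finite sets `E`, for which almost every `E` contains any prescribed finite set of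
cofinal points (`exists_isInvariantMean_finset`). So a given element has trivial germs off almost
every `E`. The elements that preserve `E` and have trivial germs off it form an amenable group,
assembled from permutations of `E`, germs in `sequenceGroup` at the points of `E`, and finitary
permutations. `isAmenableGroup_of_good` averages the means of these groups into one on the whole
group. -/

/-- A finitely additive probability on all subsets of `S`. -/
structure IsMean {S : Type*} (μ : Set S → ℝ) : Prop where
  mem_Icc : ∀ A : Set S, μ A ∈ Set.Icc (0 : ℝ) 1
  univ_eq_one : μ Set.univ = 1
  additive : ∀ A B : Set S, Disjoint A B → μ (A ∪ B) = μ A + μ B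

section Mean

variable {S T : Type*} {μ : Set S → ℝ}

theorem IsInvariantMean.isMean {G : Type*} [Group G] [MulAction G S]
    (h : IsInvariantMean G S μ) : IsMean μ :=
  ⟨h.mem_Icc, h.univ_eq_one, h.additive⟩

theorem IsInvariantMean.preimage {G : Type*} [Group G] [MulAction G S]
    (h : IsInvariantMean G S μ) (g : G) (A : Set S) : μ ((fun s => g • s) ⁻¹' A) = μ A := by
  have h1 := h.invariant g ((fun s => g • s) ⁻¹' A)
  rwa [Set.image_preimage_eq _ (MulAction.surjective g), eq_comm] at h1

theorem IsMean.isInvariantMean {G : Type*} [Group G] [MulAction G S] (h : IsMean μ)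
    (hinv : ∀ (g : G) (A : Set S), μ ((fun s => g • s) ⁻¹' A) = μ A) : IsInvariantMean G S μ := by
  refine ⟨h.mem_Icc, h.univ_eq_one, h.additive, fun g A => ?_⟩
  rw [← hinv g, Set.preimage_image_eq _ (MulAction.injective g)]

theorem IsMean.map (h : IsMean μ) (f : S → T) : IsMean (fun A : Set T => μ (f ⁻¹' A)) :=
  ⟨fun _ => h.mem_Icc _, h.univ_eq_one, fun A B hAB => by
    rw [Set.preimage_union, h.additive _ _ (hAB.preimage f)]⟩

theorem IsMean.empty (h : IsMean μ) : μ ∅ = 0 := by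
  have := h.additive ∅ ∅ (by simp)
  simp at this
  exact this

theorem IsMean.mono (h : IsMean μ) {A B : Set S} (hAB : A ⊆ B) : μ A ≤ μ B := by
  have h1 := h.additive A (B \ A) Set.disjoint_sdiff_right
  rw [Set.union_sdiff_cancel hAB] at h1
  linarith [(h.mem_Icc (B \ A)).1]

theorem IsMean.eq_zero_of_disjoint (h : IsMean μ) {A B : Set S} (hA : μ A = 1)
    (hAB : Disjoint A B) : μ B = 0 := by
  have h1 := h.additive A B hAB
  linarith [(h.mem_Icc (A ∪ B)).2, (h.mem_Icc B).1]

theorem IsMean.preimage_finset (h : IsMean μ) {δ : Type*} (r : S → δ) (D : Finset δ) :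
    μ (r ⁻¹' D) = ∑ d ∈ D, μ (r ⁻¹' {d}) := by
  classical
  induction D using Finset.induction_on with
  | empty => simp [h.empty]
  | insert d D hd ih =>
    rw [Finset.sum_insert hd, ← ih, Finset.coe_insert, Set.insert_eq, Set.preimage_union,
      h.additive]
    exact Disjoint.preimage r (by simpa using hd)

/-- The uniform mean on the image of a nonempty finite set. -/
theorem isMean_uniform {ι : Type*} (F : Finset ι) (hF : F.Nonempty) (f : ι → S) :
    IsMean (fun A : Set S => by
      classical exact ((F.filter fun i => f i ∈ A).card : ℝ) / F.card) := by
  classical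
  have hpos : (0 : ℝ) < F.card := by exact_mod_cast hF.card_pos
  refine ⟨fun A => ⟨by positivity, ?_⟩, by simp [hpos.ne'], fun A B hAB => ?_⟩
  · rw [div_le_one hpos]
    exact_mod_cast Finset.card_filter_le _ _
  · rw [← add_div, ← Nat.cast_add, ← Finset.card_union_of_disjoint, ← Finset.filter_or]
    · simp only [Set.mem_union]
    · rw [Finset.disjoint_filter]
      exact fun i _ hA hB => Set.disjoint_left.1 hAB hA hB

/-- Means have cluster points: an ultralimit of means. -/
theorem exists_isMean_limit {ι : Type*} (l : Filter ι) [l.NeBot] (m : ι → Set S → ℝ)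
    (hm : ∀ i, IsMean (m i)) :
    ∃ μ : Set S → ℝ, IsMean μ ∧
      (∀ A B, Tendsto (fun i => m i A - m i B) l (𝓝 0) → μ A = μ B) ∧
      (∀ A, (∀ᶠ i in l, m i A = 1) → μ A = 1) := by
  -- A single ultrafilter finer than `l` makes all bounded sequences converge at once, and keeps
  -- every limit that exists along `l`.
  let U : Ultrafilter ι := Ultrafilter.of l
  have hU : (U : Filter ι) ≤ l := Ultrafilter.of_le l
  have key : ∀ A : Set S, ∃ c ∈ Set.Icc (0 : ℝ) 1, Tendsto (fun i => m i A) U (𝓝 c) := by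
    intro A
    obtain ⟨c, hc, h⟩ := (isCompact_Icc (a := (0 : ℝ)) (b := 1)).ultrafilter_le_nhds
      (U.map fun i => m i A) (by
        rw [le_principal_iff]
        exact Filter.mem_map.2 (Filter.univ_mem' fun i => (hm i).mem_Icc A))
    exact ⟨c, hc, h⟩
  choose μ hμ1 hμ2 using key
  refine ⟨μ, ⟨hμ1, ?_, fun A B hAB => ?_⟩, fun A B hAB => ?_, fun A hA => ?_⟩
  · refine tendsto_nhds_unique (hμ2 _) ?_
    simp [(hm _).univ_eq_one]
  · refine tendsto_nhds_unique (hμ2 _) ?_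
    simpa [(hm _).additive A B hAB] using (hμ2 A).add (hμ2 B)
  · have h1 := tendsto_nhds_unique ((hμ2 A).sub (hμ2 B)) (hAB.mono_left hU)
    linarith
  · refine tendsto_nhds_unique (hμ2 _) ?_
    exact tendsto_const_nhds.congr' ((Filter.Eventually.filter_mono hU hA).mono fun i hi => hi.symm)

/-! ### Integration against a mean -/

/-- The integral of a function with finitely many values against a mean. -/
noncomputable def simpleIntegral (μ : Set S → ℝ) (f : S → ℝ) : ℝ :=
  ∑ᶠ c : ℝ, c * μ (f ⁻¹' {c})

theorem IsMean.simpleIntegral_eq (h : IsMean μ) {δ : Type*} (q : δ → ℝ) (r : S → δ)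
    (D : Finset δ) (hr : ∀ s, r s ∈ D) :
    simpleIntegral μ (fun s => q (r s)) = ∑ d ∈ D, q d * μ (r ⁻¹' {d}) := by
  classical
  unfold simpleIntegral
  rw [finsum_eq_sum_of_support_subset (s := D.image q)]
  · rw [← Finset.sum_fiberwise_of_maps_to (g := q) (t := D.image q)
      (fun d hd => Finset.mem_image_of_mem q hd)]
    refine Finset.sum_congr rfl fun c _ => ?_
    have : (fun s => q (r s)) ⁻¹' {c} = r ⁻¹' (D.filter fun d => q d = c : Finset δ) := by
      ext s
      simp [hr]
    rw [this, h.preimage_finset, Finset.mul_sum]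
    refine Finset.sum_congr rfl fun d hd => ?_
    rw [(Finset.mem_filter.1 hd).2]
  · intro c hc
    rw [Function.mem_support] at hc
    by_contra hc'
    apply hc
    have : (fun s => q (r s)) ⁻¹' {c} = ∅ := by
      ext s
      simp only [Set.mem_preimage, Set.mem_singleton_iff, Set.mem_empty_iff_false, iff_false]
      rintro rfl
      exact hc' (by simpa using ⟨r s, hr s, rfl⟩)
    rw [this, h.empty, mul_zero]

/-- The partition by joint values refines the level sets of both functions, so integrals of
expressions in the two can be compared term by term. -/
theorem IsMean.simpleIntegral_pair (h : IsMean μ) (q : ℕ × ℕ → ℝ) {k l : S → ℕ} {B : ℕ}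
    (hk : ∀ s, k s ≤ B) (hl : ∀ s, l s ≤ B) :
    simpleIntegral μ (fun s => q (k s, l s)) =
      ∑ d ∈ Finset.range (B + 1) ×ˢ Finset.range (B + 1),
        q d * μ ((fun s => (k s, l s)) ⁻¹' {d}) :=
  h.simpleIntegral_eq q _ _ fun s => by
    simp [hk s, hl s]

theorem IsMean.simpleIntegral_add (h : IsMean μ) {k l : S → ℕ} {B : ℕ}
    (hk : ∀ s, k s ≤ B) (hl : ∀ s, l s ≤ B) :
    simpleIntegral μ (fun s => ((k s + l s : ℕ) : ℝ)) =
      simpleIntegral μ (fun s => (k s : ℝ)) + simpleIntegral μ (fun s => (l s : ℝ)) := by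
  rw [h.simpleIntegral_pair (fun d => ((d.1 + d.2 : ℕ) : ℝ)) hk hl,
    h.simpleIntegral_pair (fun d => (d.1 : ℝ)) hk hl,
    h.simpleIntegral_pair (fun d => (d.2 : ℝ)) hk hl, ← Finset.sum_add_distrib]
  exact Finset.sum_congr rfl fun d _ => by push_cast; ring

theorem IsMean.simpleIntegral_congr (h : IsMean μ) {k l : S → ℕ} {B : ℕ}
    (hk : ∀ s, k s ≤ B) (hl : ∀ s, l s ≤ B) (hkl : μ {s | k s = l s} = 1) :
    simpleIntegral μ (fun s => (k s : ℝ)) = simpleIntegral μ (fun s => (l s : ℝ)) := by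
  rw [h.simpleIntegral_pair (fun d => (d.1 : ℝ)) hk hl,
    h.simpleIntegral_pair (fun d => (d.2 : ℝ)) hk hl]
  refine Finset.sum_congr rfl fun d _ => ?_
  by_cases hd : d.1 = d.2
  · rw [hd]
  · rw [h.eq_zero_of_disjoint hkl, mul_zero, mul_zero]
    rw [Set.disjoint_left]
    rintro s hs rfl
    exact hd hs

theorem IsMean.simpleIntegral_nonneg (h : IsMean μ) {k : S → ℕ} {B : ℕ} (hk : ∀ s, k s ≤ B) :
    0 ≤ simpleIntegral μ (fun s => (k s : ℝ)) := by
  rw [h.simpleIntegral_pair (fun d => (d.1 : ℝ)) hk hk]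
  exact Finset.sum_nonneg fun d _ => mul_nonneg (Nat.cast_nonneg _) (h.mem_Icc _).1

theorem IsMean.simpleIntegral_const (h : IsMean μ) (n : ℕ) :
    simpleIntegral μ (fun _ => (n : ℝ)) = n := by
  rw [h.simpleIntegral_eq (fun d : ℕ => (d : ℝ)) (fun _ => n) {n} (by simp)]
  simp [h.univ_eq_one]

theorem IsMean.simpleIntegral_mono (h : IsMean μ) {k l : S → ℕ} {B : ℕ}
    (hl : ∀ s, l s ≤ B) (hkl : ∀ s, k s ≤ l s) :
    simpleIntegral μ (fun s => (k s : ℝ)) ≤ simpleIntegral μ (fun s => (l s : ℝ)) := by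
  have h1 := h.simpleIntegral_add (k := k) (l := fun s => l s - k s) (B := B)
    (fun s => (hkl s).trans (hl s)) (fun s => (Nat.sub_le _ _).trans (hl s))
  have h2 := h.simpleIntegral_nonneg (k := fun s => l s - k s) (B := B)
    (fun s => (Nat.sub_le _ _).trans (hl s))
  simp only [Nat.add_sub_cancel' (hkl _)] at h1
  linarith

/-- The `n`-th approximation of the integral of a function with values in `[0, 1]`. -/
noncomputable def approxIntegral (μ : Set S → ℝ) (f : S → ℝ) (n : ℕ) : ℝ :=
  simpleIntegral μ (fun s => ((⌊((n : ℝ) + 1) * f s⌋₊ : ℕ) : ℝ)) / (n + 1)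

theorem floor_mul_le {f : S → ℝ} (hf : ∀ s, f s ∈ Set.Icc (0 : ℝ) 1) (n : ℕ) (s : S) :
    ⌊((n : ℝ) + 1) * f s⌋₊ ≤ n + 1 := by
  apply Nat.floor_le_of_le
  push_cast
  exact mul_le_of_le_one_right (by positivity) (hf s).2

theorem IsMean.approxIntegral_mem (h : IsMean μ) {f : S → ℝ}
    (hf : ∀ s, f s ∈ Set.Icc (0 : ℝ) 1) (n : ℕ) : approxIntegral μ f n ∈ Set.Icc (0 : ℝ) 1 := by
  refine ⟨div_nonneg (h.simpleIntegral_nonneg (floor_mul_le hf n)) (by positivity), ?_⟩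
  unfold approxIntegral
  rw [div_le_one (by positivity)]
  refine (h.simpleIntegral_mono (l := fun _ => n + 1) (B := n + 1) (fun _ => le_rfl)
    (floor_mul_le hf n)).trans ?_
  rw [h.simpleIntegral_const]
  simp

/-- The floor of a sum exceeds the sum of the floors by at most one; after division by `n + 1` this
error tends to zero. -/
theorem IsMean.approxIntegral_add (h : IsMean μ) {f g : S → ℝ}
    (hf : ∀ s, f s ∈ Set.Icc (0 : ℝ) 1) (hg : ∀ s, g s ∈ Set.Icc (0 : ℝ) 1)
    (hfg : ∀ s, f s + g s ∈ Set.Icc (0 : ℝ) 1) (n : ℕ) :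
    approxIntegral μ f n + approxIntegral μ g n ≤ approxIntegral μ (fun s => f s + g s) n ∧
    approxIntegral μ (fun s => f s + g s) n ≤
      approxIntegral μ f n + approxIntegral μ g n + 1 / ((n : ℝ) + 1) := by
  have hn : (0 : ℝ) < (n : ℝ) + 1 := by positivity
  have hadd := h.simpleIntegral_add (floor_mul_le hf n) (floor_mul_le hg n)
  have hadd' := h.simpleIntegral_add (B := 2 * (n + 1))
    (k := fun s => ⌊((n : ℝ) + 1) * f s⌋₊ + ⌊((n : ℝ) + 1) * g s⌋₊) (l := fun _ => 1)
    (fun s => by have := floor_mul_le hf n s; have := floor_mul_le hg n s; omega)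
    (fun s => by omega)
  rw [h.simpleIntegral_const, hadd] at hadd'
  unfold approxIntegral
  rw [← add_div, ← add_div]
  constructor
  · refine div_le_div_of_nonneg_right ?_ hn.le
    rw [← hadd]
    refine h.simpleIntegral_mono (floor_mul_le hfg n) fun s => ?_
    rw [mul_add]
    refine Nat.le_floor ?_
    push_cast
    exact add_le_add (Nat.floor_le (mul_nonneg hn.le (hf s).1))
      (Nat.floor_le (mul_nonneg hn.le (hg s).1))
  · refine div_le_div_of_nonneg_right ?_ hn.le
    rw [Nat.cast_one] at hadd'
    rw [← hadd']
    refine h.simpleIntegral_mono (B := 2 * (n + 1) + 1)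
      (fun s => by have := floor_mul_le hf n s; have := floor_mul_le hg n s; omega) fun s => ?_
    rw [mul_add]
    have h1 := Nat.lt_floor_add_one (((n : ℝ) + 1) * f s)
    have h2 := Nat.lt_floor_add_one (((n : ℝ) + 1) * g s)
    rw [← Nat.lt_succ_iff, Nat.floor_lt (add_nonneg (mul_nonneg hn.le (hf s).1)
      (mul_nonneg hn.le (hg s).1))]
    push_cast
    linarith

/-- Functions with values in the unit interval can be integrated against a mean. -/
theorem IsMean.exists_integral (h : IsMean μ) :
    ∃ I : (S → ℝ) → ℝ, (∀ f, (∀ s, f s ∈ Set.Icc (0 : ℝ) 1) → I f ∈ Set.Icc (0 : ℝ) 1) ∧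
      I (fun _ => 1) = 1 ∧
      (∀ f g, (∀ s, f s ∈ Set.Icc (0 : ℝ) 1) → (∀ s, g s ∈ Set.Icc (0 : ℝ) 1) →
        (∀ s, f s + g s ∈ Set.Icc (0 : ℝ) 1) → I (fun s => f s + g s) = I f + I g) ∧
      (∀ f g, (∀ s, f s ∈ Set.Icc (0 : ℝ) 1) → (∀ s, g s ∈ Set.Icc (0 : ℝ) 1) →
        μ {s | f s = g s} = 1 → I f = I g) ∧
      (∀ (f : S → ℝ) (t : S → S), (∀ A, μ (t ⁻¹' A) = μ A) → I (fun s => f (t s)) = I f) := by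
  let U : Ultrafilter ℕ := Ultrafilter.of atTop
  have hU : (U : Filter ℕ) ≤ atTop := Ultrafilter.of_le atTop
  have key : ∀ f : S → ℝ, (∀ s, f s ∈ Set.Icc (0 : ℝ) 1) →
      ∃ c ∈ Set.Icc (0 : ℝ) 1, Tendsto (approxIntegral μ f) U (𝓝 c) := by
    intro f hf
    obtain ⟨c, hc, h⟩ := (isCompact_Icc (a := (0 : ℝ)) (b := 1)).ultrafilter_le_nhds
      (U.map (approxIntegral μ f)) (by
        rw [le_principal_iff]
        exact Filter.mem_map.2 (Filter.univ_mem' fun i => h.approxIntegral_mem hf i))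
    exact ⟨c, hc, h⟩
  -- For functions with values outside the unit interval this may be a default value. The invariance
  -- clause still holds for them, because the approximations coincide.
  let I : (S → ℝ) → ℝ := fun f => limUnder (U : Filter ℕ) (approxIntegral μ f)
  have hI : ∀ f, (∀ s, f s ∈ Set.Icc (0 : ℝ) 1) →
      I f ∈ Set.Icc (0 : ℝ) 1 ∧ Tendsto (approxIntegral μ f) U (𝓝 (I f)) := by
    intro f hf
    obtain ⟨c, hc, hlim⟩ := key f hf
    have : I f = c := hlim.limUnder_eq
    rw [this]
    exact ⟨hc, hlim⟩
  refine ⟨I, fun f hf => (hI f hf).1, ?_, fun f g hf hg hfg => ?_, fun f g hf hg hfg => ?_,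
    fun f t ht => ?_⟩
  · refine tendsto_nhds_unique (hI _ (by simp)).2 ?_
    refine tendsto_const_nhds.congr fun n => ?_
    have : ⌊((n : ℝ) + 1) * 1⌋₊ = n + 1 := by
      rw [mul_one]
      exact_mod_cast Nat.floor_natCast (R := ℝ) (n + 1)
    unfold approxIntegral
    dsimp only
    rw [this, h.simpleIntegral_const]
    push_cast
    rw [div_self (by positivity)]
  · have h1 := (hI f hf).2.add (hI g hg).2
    have h2 : Tendsto (fun n : ℕ => 1 / ((n : ℝ) + 1)) U (𝓝 0) :=
      tendsto_one_div_add_atTop_nhds_zero_nat.mono_left hU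
    have h3 := h1.add h2
    rw [add_zero] at h3
    exact tendsto_nhds_unique (hI _ hfg).2 (tendsto_of_tendsto_of_tendsto_of_le_of_le h1 h3
      (fun n => (h.approxIntegral_add hf hg hfg n).1)
      (fun n => (h.approxIntegral_add hf hg hfg n).2))
  · refine tendsto_nhds_unique (hI f hf).2 ((hI g hg).2.congr fun n => ?_)
    unfold approxIntegral
    rw [h.simpleIntegral_congr (floor_mul_le hf n) (floor_mul_le hg n)]
    refine le_antisymm (h.mem_Icc _).2 (hfg ▸ h.mono fun s hs => ?_)
    rw [Set.mem_ofPred_eq] at hs ⊢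
    rw [hs]
  · have : approxIntegral μ (fun s => f (t s)) = approxIntegral μ f := by
      funext n
      unfold approxIntegral simpleIntegral
      congr 1
      refine finsum_congr fun c => ?_
      rw [← ht ((fun s => ((⌊((n : ℝ) + 1) * f s⌋₊ : ℕ) : ℝ)) ⁻¹' {c})]
      rfl
    simp only [I, this]

end Mean

/-! ### Amenable groups -/

section Amenable

/-- A group acting on a set with an invariant mean is amenable as soon as the "good" parts of the
stabilizers are amenable, where goodness is a groupoid-like condition on pairs `(g, s)` which
for every `g` holds for almost all `s`. -/
theorem isAmenableGroup_of_good {G S : Type*} [Group G] [MulAction G S] {ν : Set S → ℝ}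
    (hν : IsInvariantMean G S ν) (good : G → S → Prop) (hone : ∀ s, good 1 s)
    (hmul : ∀ g h s, good h s → good g (h • s) → good (g * h) s)
    (hinv : ∀ g s, good g s → good g⁻¹ (g • s))
    (hfull : ∀ g, ν {s | good g s} = 1)
    (hstab : ∀ (s : S) (H : Subgroup G), (∀ h, h ∈ H ↔ h • s = s ∧ good h s) →
      IsAmenableGroup H) : IsAmenableGroup G := by
  -- The action restricted to good pairs is a groupoid, and `R` is its orbit relation; each orbit
  -- may be treated separately.
  let R : Setoid S :=
    { r := fun s t => ∃ g : G, g • s = t ∧ good g s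
      iseqv :=
        { refl := fun s => ⟨1, one_smul _ _, hone s⟩
          symm := by
            rintro s _ ⟨g, rfl, hg⟩
            exact ⟨g⁻¹, inv_smul_smul _ _, hinv g s hg⟩
          trans := by
            rintro s _ _ ⟨g, rfl, hg⟩ ⟨h, rfl, hh⟩
            exact ⟨h * g, mul_smul _ _ _, hmul _ _ _ hg hh⟩ } }
  let rep : S → S := fun s => (Quotient.mk R s).out
  have hrep : ∀ s, ∃ g : G, g • rep s = s ∧ good g (rep s) := fun s => Quotient.mk_out (s := R) s
  have hrep' : ∀ g s, good g s → rep (g • s) = rep s := fun g s hg => by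
    have : Quotient.mk R s = Quotient.mk R (g • s) := Quotient.sound ⟨g, rfl, hg⟩
    simp only [rep, this]
  choose κ hκ1 hκ2 using hrep
  let H : S → Subgroup G := fun s =>
    { carrier := {h | h • s = s ∧ good h s}
      one_mem' := ⟨one_smul _ _, hone s⟩
      mul_mem' := by
        rintro a b ⟨ha, ha'⟩ ⟨hb, hb'⟩
        exact ⟨by rw [mul_smul, hb, ha], hmul _ _ _ hb' (by rwa [hb])⟩
      inv_mem' := by
        rintro a ⟨ha, ha'⟩
        exact ⟨by rw [inv_smul_eq_iff, ha], by simpa [ha] using hinv a s ha'⟩ }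
  have hH : ∀ s, IsAmenableGroup (H s) := fun s => hstab s (H s) fun h => Iff.rfl
  choose m hm using hH
  -- The mean of the good stabilizer of `rep s`, transported to the coset of good elements carrying
  -- `rep s` to `s`.
  let M : S → Set G → ℝ := fun s A => m (rep s) ((fun h : H (rep s) => κ s * (h : G)) ⁻¹' A)
  have hM : ∀ s, IsMean (M s) := fun s => (hm (rep s)).isMean.map _
  have hMg : ∀ g s, good g s → ∀ A, M (g • s) A = M s ((fun x => g * x) ⁻¹' A) := by
    intro g s hg A
    -- The representative of `g • s` becomes a variable because the group on which `m` lives depends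
    -- on it.
    have key : ∀ r (hr : r = rep s), m r ((fun h : H r => κ (g • s) * (h : G)) ⁻¹' A) =
        m (rep s) ((fun h : H (rep s) => κ s * (h : G)) ⁻¹' ((fun x => g * x) ⁻¹' A)) := by
      rintro r rfl
      -- Both `g * κ s` and `κ (g • s)` are good and carry `rep s` to `g • s`, so they differ by an
      -- element of the good stabilizer, under which the mean is invariant.
      have hmem : (g * κ s)⁻¹ * κ (g • s) ∈ H (rep s) := by
        have h1 : good (g * κ s) (rep s) := hmul _ _ _ (hκ2 s) (by rwa [hκ1])
        have h2 := hinv _ _ h1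
        have h3 := hκ2 (g • s)
        rw [hrep' g s hg] at h3
        have h4 := hκ1 (g • s)
        rw [hrep' g s hg] at h4
        have h5 : (g * κ s) • rep s = g • s := by rw [mul_smul, hκ1]
        refine ⟨?_, hmul _ _ _ h3 ?_⟩
        · rw [mul_smul, inv_smul_eq_iff, h4, h5]
        · rwa [h4, ← h5]
      rw [← (hm (rep s)).preimage ⟨_, hmem⟩
        ((fun h : H (rep s) => κ s * (h : G)) ⁻¹' ((fun x => g * x) ⁻¹' A))]
      congr 1
      ext h
      simp only [Set.mem_preimage, smul_eq_mul, Subgroup.coe_mul]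
      rw [show g * (κ s * ((g * κ s)⁻¹ * κ (g • s) * (h : G))) = κ (g • s) * h by group]
    exact key _ (hrep' g s hg)
  obtain ⟨I, hI1, hI2, hI3, hI4, hI5⟩ := hν.isMean.exists_integral
  have hMI : ∀ A s, M s A ∈ Set.Icc (0 : ℝ) 1 := fun A s => (hM s).mem_Icc A
  refine ⟨fun A => I fun s => M s A, IsMean.isInvariantMean ⟨fun A => hI1 _ (hMI A), ?_,
    fun A B hAB => ?_⟩ fun g A => ?_⟩
  · simp only [(hM _).univ_eq_one, hI2]
  · rw [← hI3 _ _ (hMI A) (hMI B)]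
    · simp only [(hM _).additive A B hAB]
    · intro s
      rw [← (hM _).additive A B hAB]
      exact hMI _ s
  · rw [← hI5 (fun s => M s A) (fun s => g • s) (hν.preimage g)]
    refine hI4 _ _ (hMI _) (fun s => hMI _ _) (le_antisymm (hν.mem_Icc _).2 ?_)
    rw [← hfull g]
    exact hν.isMean.mono fun s hs => (hMg g s hs A).symm

/-- Extensions of amenable groups by amenable groups are amenable. -/
theorem isAmenableGroup_of_ker {G H : Type*} [Group G] [Group H] (f : G →* H)
    (hker : IsAmenableGroup f.ker) (hH : IsAmenableGroup H) : IsAmenableGroup G := by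
  let _ : MulAction G H := MulAction.compHom H f
  have hsmul : ∀ (g : G) (s : H), g • s = f g * s := fun _ _ => rfl
  obtain ⟨μ, hμ⟩ := hH
  refine isAmenableGroup_of_good (S := H) (ν := μ)
    (hμ.isMean.isInvariantMean fun g A => hμ.preimage (f g) A) (fun _ _ => True)
    (fun _ => trivial) (fun _ _ _ _ _ => trivial) (fun _ _ _ => trivial)
    (fun _ => by simpa using hμ.univ_eq_one) fun s K hK => ?_
  -- Left translation is free, so all stabilizers equal the kernel.
  have : K = f.ker := by
    ext g
    rw [hK, hsmul, MonoidHom.mem_ker]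
    simp
  rwa [this]

theorem isAmenableGroup_of_surjective {G H : Type*} [Group G] [Group H] (f : G →* H)
    (hf : Function.Surjective f) (hG : IsAmenableGroup G) : IsAmenableGroup H := by
  obtain ⟨μ, hμ⟩ := hG
  refine ⟨_, (hμ.isMean.map f).isInvariantMean fun h A => ?_⟩
  obtain ⟨g, rfl⟩ := hf h
  rw [← hμ.preimage g (f ⁻¹' A)]
  congr 1
  ext x
  simp

/-- It suffices to check invariance of a mean on generators. -/
theorem isInvariantMean_of_closure {G S : Type*} [Group G] [MulAction G S] {μ : Set S → ℝ}
    (h : IsMean μ) (T : Set G) (hT : Subgroup.closure T = ⊤)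
    (hinv : ∀ g ∈ T, ∀ A : Set S, μ ((fun s => g • s) ⁻¹' A) = μ A) : IsInvariantMean G S μ := by
  refine h.isInvariantMean fun g => ?_
  have hg : g ∈ Subgroup.closure T := hT ▸ Subgroup.mem_top g
  induction hg using Subgroup.closure_induction with
  | mem g hg => exact hinv g hg
  | one => simp
  | mul g h _ _ ihg ihh =>
    intro A
    rw [← ihg A, ← ihh ((fun s => g • s) ⁻¹' A), Set.preimage_preimage]
    simp only [mul_smul]
  | inv g _ ih =>
    intro A
    rw [← ih]
    simp [Set.preimage_preimage]

/-- Locally finite groups are amenable. -/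
theorem isAmenableGroup_of_locallyFinite {G : Type*} [Group G]
    (h : ∀ F : Finset G, Finite (Subgroup.closure (F : Set G))) : IsAmenableGroup G := by
  classical
  let B : Finset G → Finset G := fun F =>
    (Set.toFinite (Subgroup.closure (F : Set G) : Set G)).toFinset
  have hB : ∀ F g, g ∈ B F ↔ g ∈ Subgroup.closure (F : Set G) := fun F g => by simp [B]
  obtain ⟨μ, hμ, hμ1, -⟩ := exists_isMean_limit (atTop : Filter (Finset G)) _
    fun F => isMean_uniform (B F) ⟨1, (hB F 1).2 (one_mem _)⟩ (fun x : G => x)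
  refine ⟨μ, hμ.isInvariantMean fun g A => hμ1 _ _ ?_⟩
  refine tendsto_const_nhds.congr' ?_
  filter_upwards [eventually_ge_atTop ({g} : Finset G)] with F hF
  have hg : g ∈ Subgroup.closure (F : Set G) :=
    Subgroup.subset_closure (by simpa using hF)
  rw [eq_comm, sub_eq_zero]
  -- Once `F` contains `g`, left translation by `g` permutes the finite subgroup generated by `F`,
  -- so the two counts agree exactly.
  congr 2
  refine Finset.card_bij (fun x _ => g * x) ?_ (fun _ _ _ _ h => mul_left_cancel h) ?_
  · intro x hx
    simp only [Finset.mem_filter, hB, Set.mem_preimage, smul_eq_mul] at hx ⊢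
    exact ⟨mul_mem hg hx.1, hx.2⟩
  · intro x hx
    simp only [Finset.mem_filter, hB] at hx
    refine ⟨g⁻¹ * x, ?_, by simp⟩
    simp only [Finset.mem_filter, hB, Set.mem_preimage, smul_eq_mul, mul_inv_cancel_left]
    exact ⟨mul_mem (inv_mem hg) hx.1, hx.2⟩

theorem isAmenableGroup_of_finite (G : Type*) [Group G] [Finite G] : IsAmenableGroup G :=
  isAmenableGroup_of_locallyFinite fun _ => inferInstance

theorem isAmenableGroup_of_injective {G H : Type*} [Group G] [Group H] (f : G →* H)
    (hf : Function.Injective f) (hH : IsAmenableGroup H) : IsAmenableGroup G := by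
  refine isAmenableGroup_of_ker f ?_ hH
  rw [(MonoidHom.ker_eq_bot_iff f).2 hf]
  exact isAmenableGroup_of_finite _

theorem isAmenableGroup_subgroup_of_ker {G H : Type*} [Group G] [Group H] (K L : Subgroup G)
    (f : G →* H) (hL : ∀ x ∈ K, f x = 1 → x ∈ L) (hLa : IsAmenableGroup L)
    (hH : IsAmenableGroup H) : IsAmenableGroup K := by
  refine isAmenableGroup_of_ker (f.comp K.subtype) ?_ hH
  let φ : (f.comp K.subtype).ker →* L :=
    { toFun := fun x => ⟨x.1.1, hL _ x.1.2 x.2⟩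
      map_one' := rfl
      map_mul' := fun _ _ => rfl }
  exact isAmenableGroup_of_injective φ
    (fun x y hxy => Subtype.ext (Subtype.ext (congrArg (fun z : L => (z : G)) hxy))) hLa

/-- A group is amenable if it has finitely many homomorphisms to an amenable group whose kernels
have amenable intersection. -/
theorem isAmenableGroup_of_iInf_ker {ι G H : Type*} [Finite ι] [Group G] [Group H]
    (f : ι → G →* H) (hker : IsAmenableGroup (⨅ i, (f i).ker : Subgroup G))
    (hH : IsAmenableGroup H) : IsAmenableGroup G := by
  classical
  have key : ∀ s : Finset ι, IsAmenableGroup (⨅ i ∈ s, (f i).ker : Subgroup G) →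
      IsAmenableGroup G := by
    intro s
    induction s using Finset.induction_on with
    | empty =>
      intro h
      refine isAmenableGroup_of_surjective (Subgroup.subtype _) (fun g => ⟨⟨g, ?_⟩, rfl⟩) h
      simp
    | insert i s hi ih =>
      intro h
      refine ih (isAmenableGroup_subgroup_of_ker _ _ (f i) (fun x hx hx1 => ?_) h hH)
      rw [Finset.iInf_insert]
      exact ⟨hx1, hx⟩
  cases nonempty_fintype ι
  refine key Finset.univ ?_
  rwa [show (⨅ i ∈ Finset.univ, (f i).ker) = ⨅ i, (f i).ker by simp]

theorem isAmenableGroup_int : IsAmenableGroup (Multiplicative ℤ) := by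
  classical
  obtain ⟨μ, hμ, hμ1, -⟩ := exists_isMean_limit (atTop : Filter ℕ) _
    fun n => isMean_uniform (Finset.range (n + 1)) ⟨0, by simp⟩
      (fun i : ℕ => Multiplicative.ofAdd (i : ℤ))
  refine ⟨μ, isInvariantMean_of_closure hμ {Multiplicative.ofAdd 1} ?_ ?_⟩
  · rw [eq_top_iff]
    rintro z -
    rw [Subgroup.mem_closure_singleton]
    exact ⟨z.toAdd, by rw [← ofAdd_zsmul]; simp⟩
  · rintro _ rfl A
    refine hμ1 _ _ ?_
    refine squeeze_zero_norm (a := fun n : ℕ => 1 / ((n : ℝ) + 1)) (fun n => ?_)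
      tendsto_one_div_add_atTop_nhds_zero_nat
    have hpos : (0 : ℝ) < (n : ℝ) + 1 := by positivity
    rw [Finset.card_range, ← sub_div, norm_div, Real.norm_eq_abs, Real.norm_eq_abs]
    push_cast
    rw [abs_of_pos hpos]
    refine div_le_div_of_nonneg_right ?_ hpos.le
    set P : ℕ → Prop := fun i => Multiplicative.ofAdd (i : ℤ) ∈ A with hP
    have h1 : ∀ i : ℕ, Multiplicative.ofAdd (i : ℤ) ∈
        (fun s => Multiplicative.ofAdd (1 : ℤ) • s) ⁻¹' A ↔ P (i + 1) := by
      intro i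
      simp only [hP, Set.mem_preimage, smul_eq_mul, ← ofAdd_add]
      push_cast
      rw [add_comm]
    simp only [h1]
    have h2 : ∀ (Q : ℕ → Prop), (((Finset.range (n + 1)).filter Q).card : ℝ) =
        ∑ i ∈ Finset.range (n + 1), if Q i then (1 : ℝ) else 0 := by
      intro Q
      rw [Finset.card_filter]
      push_cast
      rfl
    have h3 := h2 P
    have h4 := h2 (fun i => P (i + 1))
    -- The sums over the interval and over its shift both arise from the sum over `n + 2` terms by
    -- dropping one end term.
    have h5 := Finset.sum_range_succ' (fun i => if P i then (1 : ℝ) else 0) (n + 1)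
    have h6 := Finset.sum_range_succ (fun i => if P i then (1 : ℝ) else 0) (n + 1)
    have h7 : (if P 0 then (1 : ℝ) else 0) ∈ Set.Icc (0 : ℝ) 1 := by split_ifs <;> simp
    have h8 : (if P (n + 1) then (1 : ℝ) else 0) ∈ Set.Icc (0 : ℝ) 1 := by split_ifs <;> simp
    rw [abs_le]
    constructor <;> linarith [h7.1, h7.2, h8.1, h8.2]

/-- Finitely generated subgroups of commutative groups are amenable. -/
theorem isAmenableGroup_closure_range {C : Type*} [Group C] (hcomm : ∀ s t : C, Commute s t)
    {k : ℕ} (c : Fin k → C) : IsAmenableGroup (Subgroup.closure (Set.range c)) := by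
  let f : (Fin k → Multiplicative ℤ) →* C := MonoidHom.noncommPiCoprod
    (fun i => zpowersHom C (c i)) (fun _ _ _ _ _ => hcomm _ _)
  have hle : Subgroup.closure (Set.range c) ≤ f.range := by
    rw [Subgroup.closure_le]
    rintro _ ⟨i, rfl⟩
    refine ⟨Pi.mulSingle i (Multiplicative.ofAdd 1), ?_⟩
    exact (MonoidHom.noncommPiCoprod_mulSingle _ i _).trans (by simp)
  refine isAmenableGroup_of_injective (Subgroup.inclusion hle) (Subgroup.inclusion_injective hle)
    (isAmenableGroup_of_surjective f.rangeRestrict f.rangeRestrict_surjective ?_)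
  refine isAmenableGroup_of_iInf_ker (fun i => Pi.evalMonoidHom _ i) ?_ isAmenableGroup_int
  have : (⨅ i, (Pi.evalMonoidHom (fun _ : Fin k => Multiplicative ℤ) i).ker) = ⊥ := by
    rw [eq_bot_iff]
    intro z hz
    rw [Subgroup.mem_iInf] at hz
    exact funext hz
  rw [this]
  exact isAmenableGroup_of_finite _

end Amenable

/-! ### Means on finite subsets -/

section FiniteSubsets

open scoped Pointwise

variable {Ω : Type*} [DecidableEq Ω]

/-- The amplitude of the finite set `E` in the product of the unit vectors
`(cos (θ η), sin (θ η))`. -/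
noncomputable def amplitude (θ : Ω → ℝ) (E : Finset Ω) : ℝ :=
  ∏ᶠ η, if η ∈ E then Real.sin (θ η) else Real.cos (θ η)

/-- The distribution of a random finite subset containing each point `η` independently with
probability `sin² (θ η)`. -/
noncomputable def bernoulliMean (θ : Ω → ℝ) (A : Set (Finset Ω)) : ℝ :=
  ∑ᶠ E, A.indicator (fun E => amplitude θ E ^ 2) E

/-- Outside `U` every factor is `cos 0 = 1`. -/
theorem amplitude_eq_prod {θ : Ω → ℝ} {U E : Finset Ω} (hU : Function.support θ ⊆ U)
    (hE : E ⊆ U) :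
    amplitude θ E = ∏ η ∈ U, if η ∈ E then Real.sin (θ η) else Real.cos (θ η) := by
  refine finprod_eq_prod_of_mulSupport_subset _ fun η hη => ?_
  by_contra hηU
  refine hη ?_
  have h1 : θ η = 0 := by
    by_contra h
    exact hηU (hU h)
  simp [h1, show η ∉ E from fun h => hηU (hE h)]

theorem amplitude_eq_zero {θ : Ω → ℝ} {E : Finset Ω} (hθ : (Function.support θ).Finite) {η : Ω}
    (h : (if η ∈ E then Real.sin (θ η) else Real.cos (θ η)) = 0) : amplitude θ E = 0 := by
  rw [amplitude_eq_prod (U := insert η (hθ.toFinset ∪ E))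
    (fun x hx => by simp at hx ⊢; tauto) (fun x hx => by simp [hx])]
  exact Finset.prod_eq_zero (Finset.mem_insert_self _ _) h

theorem amplitude_eq_zero_of_not_subset {θ : Ω → ℝ} {U E : Finset Ω}
    (hU : Function.support θ ⊆ U) (hE : ¬ E ⊆ U) : amplitude θ E = 0 := by
  obtain ⟨η, hη, hηU⟩ := Finset.not_subset.1 hE
  refine amplitude_eq_zero (U.finite_toSet.subset hU) (η := η) ?_
  have h1 : θ η = 0 := by
    by_contra h
    exact hηU (hU h)
  simp [hη, h1]

theorem bernoulliMean_eq_sum {θ : Ω → ℝ} {U : Finset Ω} (hU : Function.support θ ⊆ U)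
    (A : Set (Finset Ω)) :
    bernoulliMean θ A = ∑ E ∈ U.powerset, A.indicator (fun E => amplitude θ E ^ 2) E := by
  classical
  refine finsum_eq_sum_of_support_subset _ fun E hE => ?_
  rw [Finset.mem_coe, Finset.mem_powerset]
  by_contra h
  refine hE ?_
  rw [Set.indicator_apply, amplitude_eq_zero_of_not_subset hU h]
  simp

/-- Expanding each `cos (θ η - θ' η)` as `sin * sin + cos * cos` turns the product into a sum over
the subsets of `U`. This is the Hellinger affinity of the two random subsets. -/
theorem sum_amplitude_mul {θ θ' : Ω → ℝ} {U : Finset Ω} (hU : Function.support θ ⊆ U)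
    (hU' : Function.support θ' ⊆ U) :
    ∑ E ∈ U.powerset, amplitude θ E * amplitude θ' E = ∏ η ∈ U, Real.cos (θ η - θ' η) := by
  have h1 : ∀ η, Real.cos (θ η - θ' η) =
      Real.sin (θ η) * Real.sin (θ' η) + Real.cos (θ η) * Real.cos (θ' η) := fun η => by
    rw [Real.cos_sub, add_comm]
  simp only [h1]
  rw [Finset.prod_add]
  refine Finset.sum_congr rfl fun E hE => ?_
  rw [Finset.mem_powerset] at hE
  rw [amplitude_eq_prod hU hE, amplitude_eq_prod hU' hE, ← Finset.prod_mul_distrib,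
    ← Finset.prod_sdiff hE, mul_comm]
  congr 1
  · exact Finset.prod_congr rfl fun η hη => by simp [hη]
  · exact Finset.prod_congr rfl fun η hη => by simp [(Finset.mem_sdiff.1 hη).2]

theorem sum_amplitude_sq {θ : Ω → ℝ} {U : Finset Ω} (hU : Function.support θ ⊆ U) :
    ∑ E ∈ U.powerset, amplitude θ E ^ 2 = 1 := by
  simp only [sq]
  rw [sum_amplitude_mul hU hU]
  simp

theorem isMean_bernoulliMean {θ : Ω → ℝ} (hθ : (Function.support θ).Finite) :
    IsMean (bernoulliMean θ) := by
  have hU : Function.support θ ⊆ hθ.toFinset := by simp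
  refine ⟨fun A => ⟨?_, ?_⟩, ?_, fun A B hAB => ?_⟩
  · rw [bernoulliMean_eq_sum hU]
    exact Finset.sum_nonneg fun E _ => Set.indicator_nonneg (fun _ _ => sq_nonneg _) _
  · rw [bernoulliMean_eq_sum hU, ← sum_amplitude_sq hU]
    exact Finset.sum_le_sum fun E _ => Set.indicator_le_self' (fun _ _ => sq_nonneg _) _
  · rw [bernoulliMean_eq_sum hU, Set.indicator_univ, sum_amplitude_sq hU]
  · rw [bernoulliMean_eq_sum hU, bernoulliMean_eq_sum hU, bernoulliMean_eq_sum hU,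
      ← Finset.sum_add_distrib, Set.indicator_union_of_disjoint hAB]

/-- Induction based on `1 - a * b ≤ (1 - a) + (1 - b)` for `a, b ≤ 1`; the bound on the absolute
value is carried along to supply `b ≤ 1`. -/
theorem one_sub_prod_cos_le (U : Finset Ω) (δ : Ω → ℝ) :
    |∏ η ∈ U, Real.cos (δ η)| ≤ 1 ∧ 1 - ∏ η ∈ U, Real.cos (δ η) ≤ ∑ η ∈ U, δ η ^ 2 / 2 := by
  induction U using Finset.induction_on with
  | empty => simp
  | insert η U hη ih =>
    rw [Finset.prod_insert hη, Finset.sum_insert hη]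
    refine ⟨?_, ?_⟩
    · rw [abs_mul]
      exact mul_le_one₀ (Real.abs_cos_le_one _) (abs_nonneg _) ih.1
    · have h1 := Real.one_sub_sq_div_two_le_cos (x := δ η)
      have h2 := (abs_le.1 ih.1).2
      have h3 := Real.cos_le_one (δ η)
      nlinarith [mul_nonneg (sub_nonneg.2 h2) (sub_nonneg.2 h3), ih.2]

/-- Cauchy–Schwarz applied to `|p² - q²| = |p - q| * |p + q|`: with `c` the affinity, the squared
norms are `2 - 2c` and `2 + 2c`, whose product is at most `8 (1 - c)`. -/
theorem bernoulliMean_sub_sq_le {θ θ' : Ω → ℝ} {U : Finset Ω} (hU : Function.support θ ⊆ U)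
    (hU' : Function.support θ' ⊆ U) (A : Set (Finset Ω)) :
    (bernoulliMean θ A - bernoulliMean θ' A) ^ 2 ≤ 4 * ∑ η ∈ U, (θ η - θ' η) ^ 2 := by
  classical
  have hc := one_sub_prod_cos_le U (fun η => θ η - θ' η)
  rw [← sum_amplitude_mul hU hU', ← Finset.sum_div] at hc
  have h1 := sum_amplitude_sq hU
  have h2 := sum_amplitude_sq hU'
  set c := ∑ E ∈ U.powerset, amplitude θ E * amplitude θ' E
  have h3 : ∑ E ∈ U.powerset, |amplitude θ E - amplitude θ' E| ^ 2 = 2 - 2 * c := by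
    simp only [sq_abs, sub_sq, Finset.sum_add_distrib, Finset.sum_sub_distrib, h1, h2, mul_assoc,
      ← Finset.mul_sum]
    ring
  have h4 : ∑ E ∈ U.powerset, |amplitude θ E + amplitude θ' E| ^ 2 = 2 + 2 * c := by
    simp only [sq_abs, add_sq, Finset.sum_add_distrib, h1, h2, mul_assoc, ← Finset.mul_sum]
    ring
  have h5 := Finset.sum_mul_sq_le_sq_mul_sq U.powerset
    (fun E => |amplitude θ E - amplitude θ' E|) (fun E => |amplitude θ E + amplitude θ' E|)
  rw [h3, h4] at h5
  have h6 : |bernoulliMean θ A - bernoulliMean θ' A| ≤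
      ∑ E ∈ U.powerset, |amplitude θ E - amplitude θ' E| * |amplitude θ E + amplitude θ' E| := by
    rw [bernoulliMean_eq_sum hU, bernoulliMean_eq_sum hU', ← Finset.sum_sub_distrib]
    refine (Finset.abs_sum_le_sum_abs _ _).trans (Finset.sum_le_sum fun E _ => ?_)
    rw [← abs_mul, Set.indicator_apply, Set.indicator_apply]
    split_ifs
    · exact le_of_eq (congrArg _ (by ring))
    · rw [sub_zero, abs_zero]
      positivity
  have h7 := pow_le_pow_left₀ (abs_nonneg _) h6 2
  rw [sq_abs] at h7
  have h8 := abs_le.1 hc.1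
  nlinarith [hc.2]

variable {G : Type*} [Group G] [MulAction G Ω]

theorem amplitude_smul (θ : Ω → ℝ) (g : G) (E : Finset Ω) :
    amplitude θ (g • E) = amplitude (fun η => θ (g • η)) E := by
  unfold amplitude
  rw [← finprod_comp_equiv (MulAction.toPerm g)]
  simp

theorem bernoulliMean_smul (θ : Ω → ℝ) (g : G) (A : Set (Finset Ω)) :
    bernoulliMean (fun η => θ (g • η)) ((fun E => g • E) ⁻¹' A) = bernoulliMean θ A := by
  classical
  unfold bernoulliMean
  rw [← finsum_comp_equiv (MulAction.toPerm g)
    (f := fun E => A.indicator (fun E => amplitude θ E ^ 2) E)]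
  refine finsum_congr fun E => ?_
  simp only [MulAction.toPerm_apply, Set.indicator_apply, amplitude_smul, Set.mem_preimage]

/-- If there are finitely supported functions of vanishing energy that are eventually maximal at
the points of `C`, then there is an invariant mean on finite subsets, almost all of which contain
any given finite subset of `C`. -/
theorem exists_isInvariantMean_finset (T : Set G) (hT : Subgroup.closure T = ⊤) (θ : ℕ → Ω → ℝ)
    (hθ : ∀ n, (Function.support (θ n)).Finite) (ε : G → ℕ → ℝ)
    (hε : ∀ g ∈ T, Tendsto (ε g) atTop (𝓝 0))
    (hθε : ∀ g ∈ T, ∀ n (U : Finset Ω), ∑ η ∈ U, (θ n η - θ n (g • η)) ^ 2 ≤ ε g n)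
    (C : Set Ω) (hC : ∀ η ∈ C, ∀ᶠ n in atTop, θ n η = Real.pi / 2) :
    ∃ ν, IsInvariantMean G (Finset Ω) ν ∧ ∀ E₀ : Finset Ω, (E₀ : Set Ω) ⊆ C →
      ν {E | E₀ ⊆ E} = 1 := by
  obtain ⟨ν, hν, hν1, hν2⟩ := exists_isMean_limit atTop (fun n => bernoulliMean (θ n))
    fun n => isMean_bernoulliMean (hθ n)
  classical
  refine ⟨ν, isInvariantMean_of_closure hν T hT fun g hg A => hν1 _ _ ?_, fun E₀ hE₀ => hν2 _ ?_⟩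
  · have h0 : Tendsto (fun n => Real.sqrt (4 * ε g n)) atTop (𝓝 0) := by
      simpa using ((hε g hg).const_mul 4).sqrt
    refine squeeze_zero_norm (fun n => ?_) h0
    -- This trades two events for one parameter into one event for two parameters, the case covered
    -- by the Hellinger bound.
    rw [← bernoulliMean_smul (θ n) g A, Real.norm_eq_abs]
    refine Real.abs_le_sqrt ?_
    have hfin : (Function.support fun η => θ n (g • η)).Finite :=
      (hθ n).preimage (MulAction.injective g).injOn
    refine (bernoulliMean_sub_sq_le (U := (hθ n).toFinset ∪ hfin.toFinset) (by simp) (by simp)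
      _).trans ?_
    exact mul_le_mul_of_nonneg_left (hθε g hg n _) (by norm_num)
  · have h1 : ∀ᶠ n in atTop, ∀ η ∈ E₀, θ n η = Real.pi / 2 :=
      (Filter.eventually_all_finset E₀).2 fun η hη => hC η (hE₀ hη)
    filter_upwards [h1] with n hn
    rw [← (isMean_bernoulliMean (hθ n)).univ_eq_one]
    unfold bernoulliMean
    refine finsum_congr fun E => ?_
    rw [Set.indicator_univ, Set.indicator_apply]
    split_ifs with hE
    · rfl
    · obtain ⟨η, hη, hηE⟩ := Finset.not_subset.1 hE
      -- Since `cos (π / 2) = 0`, a set that omits a point of `E₀` has probability zero.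
      rw [amplitude_eq_zero (hθ n) (η := η) (by simp [hηE, hn η hη])]
      simp

end FiniteSubsets

/-! ### The action on the boundary -/

section Boundary

variable {X : ℕ → Type u} {G : ℕ → Type v} [∀ i, Group (G i)] [∀ i, MulAction (G i) (X i)]

/-- The sequence `ζ` leaves the ray `η` at position `j`, with letter `y j`. -/
def BranchesAt (y η : ∀ i, X i) (j : ℕ) (ζ : ∀ i, X i) : Prop :=
  (∀ l < j, ζ l = η l) ∧ ζ j ≠ η j ∧ ζ j = y j

/-- The boundary map of `α`. -/
def alphaBoundary (b : ∀ i, G i) (ζ : ∀ i, X i) : ∀ i, X i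
  | 0 => b 0 • ζ 0
  | i + 1 => ζ (i + 1)

open Classical in
/-- The boundary map of `β`, directed along the ray `η`. -/
noncomputable def betaBoundary (y η : ∀ i, X i) (s : ∀ i, G (i + 1)) (ζ : ∀ i, X i) : ∀ i, X i
  | 0 => ζ 0
  | i + 1 => if BranchesAt y η i ζ then s i • ζ (i + 1) else ζ (i + 1)

theorem betaBoundary_apply_of_agree (y : ∀ i, X i) {η ζ : ∀ i, X i} (s : ∀ i, G (i + 1)) {n : ℕ}
    (h : ∀ l < n, ζ l = η l) {i : ℕ} (hi : i ≤ n) : betaBoundary y η s ζ i = ζ i := by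
  cases i with
  | zero => rfl
  | succ j => exact if_neg fun hj => hj.2.1 (h j hi)

theorem betaBoundary_self (y η : ∀ i, X i) (s : ∀ i, G (i + 1)) : betaBoundary y η s η = η :=
  funext fun i => betaBoundary_apply_of_agree y s (n := i) (fun _ _ => rfl) le_rfl

theorem betaBoundary_agree_iff (y η ζ : ∀ i, X i) (s : ∀ i, G (i + 1)) (n : ℕ) :
    (∀ l < n, betaBoundary y η s ζ l = η l) ↔ ∀ l < n, ζ l = η l := by
  induction n with
  | zero => simp
  | succ n ih =>
    rw [Nat.forall_lt_succ_right, Nat.forall_lt_succ_right, ih]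
    refine and_congr_right fun h => ?_
    rw [betaBoundary_apply_of_agree y s h le_rfl]

theorem branchesAt_betaBoundary_iff (y η ζ : ∀ i, X i) (s : ∀ i, G (i + 1)) (j : ℕ) :
    BranchesAt y η j (betaBoundary y η s ζ) ↔ BranchesAt y η j ζ := by
  unfold BranchesAt
  rw [betaBoundary_agree_iff]
  refine and_congr_right fun h => ?_
  rw [betaBoundary_apply_of_agree y s h le_rfl]

theorem betaBoundary_mul (y η : ∀ i, X i) (s t : ∀ i, G (i + 1)) (ζ : ∀ i, X i) :
    betaBoundary y η (s * t) ζ = betaBoundary y η s (betaBoundary y η t ζ) := by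
  funext i
  cases i with
  | zero => rfl
  | succ i =>
    by_cases h : BranchesAt y η i ζ <;>
      simp [betaBoundary, branchesAt_betaBoundary_iff, h, mul_smul]

theorem betaBoundary_one (y η : ∀ i, X i) (ζ : ∀ i, X i) :
    betaBoundary y η (1 : ∀ i, G (i + 1)) ζ = ζ := by
  funext i
  cases i <;> simp [betaBoundary]

/-- Branching before `N` is excluded on both sides, and branching from `N` on depends only on the
tails. This moves the model of a germ from `η` to its image, which is what makes germs compose. -/
theorem betaBoundary_congr {y η η' ζ ζ' : ∀ i, X i} (s : ∀ i, G (i + 1)) {N : ℕ}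
    (h : ∀ l < N, ζ l = η l) (h' : ∀ l < N, ζ' l = η' l) (hζ : ∀ i, N ≤ i → ζ' i = ζ i)
    (hη : ∀ i, N ≤ i → η' i = η i) {i : ℕ} (hi : N ≤ i) :
    betaBoundary y η' s ζ' i = betaBoundary y η s ζ i := by
  cases i with
  | zero => exact hζ 0 hi
  | succ j =>
    have key : BranchesAt y η' j ζ' ↔ BranchesAt y η j ζ := by
      by_cases hj : j < N
      · exact ⟨fun H => absurd (h' j hj) H.2.1, fun H => absurd (h j hj) H.2.1⟩
      · rw [not_lt] at hj
        unfold BranchesAt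
        rw [hζ j hj, hη j hj]
        refine and_congr_left fun _ => forall₂_congr fun l hl => ?_
        by_cases hlN : l < N
        · exact iff_of_true (h' l hlN) (h l hlN)
        · rw [hζ l (not_lt.1 hlN), hη l (not_lt.1 hlN)]
    simp only [betaBoundary, hζ _ hi]
    classical exact if_congr key rfl rfl

/-- The action on the boundary by `α`. -/
def alphaPerm : (∀ i, G i) →* Equiv.Perm (∀ i, X i) :=
  MonoidHom.toHomPerm
    { toFun := fun b => (alphaBoundary b : Function.End (∀ i, X i))
      map_one' := by
        funext ζ i
        cases i
        · exact one_smul _ _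
        · rfl
      map_mul' := by
        intro b c
        funext ζ i
        cases i
        · exact mul_smul _ _ _
        · rfl }

/-- The action on the boundary by `β`, directed along the ray `η`. -/
noncomputable def betaPerm (y η : ∀ i, X i) : (∀ i, G (i + 1)) →* Equiv.Perm (∀ i, X i) :=
  MonoidHom.toHomPerm
    { toFun := fun s => (betaBoundary y η s : Function.End (∀ i, X i))
      map_one' := funext fun ζ => betaBoundary_one y η ζ
      map_mul' := fun s t => funext fun ζ => betaBoundary_mul y η s t ζ }

theorem alphaPerm_apply (b : ∀ i, G i) (ζ : ∀ i, X i) : alphaPerm b ζ = alphaBoundary b ζ := rfl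

theorem betaPerm_apply (y η : ∀ i, X i) (s : ∀ i, G (i + 1)) (ζ : ∀ i, X i) :
    betaPerm y η s ζ = betaBoundary y η s ζ := rfl

/-- The permutations of the boundary that preserve the lengths of common prefixes. -/
def treePerm (X : ℕ → Type u) : Subgroup (Equiv.Perm (∀ i, X i)) where
  carrier := {h | ∀ n ζ ζ', (∀ l < n, h ζ l = h ζ' l) ↔ ∀ l < n, ζ l = ζ' l}
  one_mem' := fun _ _ _ => Iff.rfl
  mul_mem' := fun {g h} hg hh n ζ ζ' => (hg n (h ζ) (h ζ')).trans (hh n ζ ζ')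
  inv_mem' := fun {g} hg n ζ ζ' => by simpa using (hg n (g⁻¹ ζ) (g⁻¹ ζ')).symm

/-- One implication suffices: the other is the same statement for `s⁻¹`. -/
theorem mem_treePerm_of_hom {H : Type*} [Group H] (f : H →* Equiv.Perm (∀ i, X i))
    (hf : ∀ s n ζ ζ', (∀ l < n, ζ l = ζ' l) → ∀ l < n, f s ζ l = f s ζ' l) (s : H) :
    f s ∈ treePerm X :=
  fun n ζ ζ' => ⟨fun h => by simpa [← Equiv.Perm.mul_apply, ← map_mul] using hf s⁻¹ n _ _ h,
    hf s n ζ ζ'⟩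

theorem alphaPerm_mem_treePerm (b : ∀ i, G i) : alphaPerm (X := X) b ∈ treePerm X := by
  refine mem_treePerm_of_hom _ (fun b n ζ ζ' h l hl => ?_) b
  cases l <;> simp [alphaPerm_apply, alphaBoundary, h _ hl]

theorem betaPerm_mem_treePerm (y η : ∀ i, X i) (s : ∀ i, G (i + 1)) :
    betaPerm y η s ∈ treePerm X := by
  refine mem_treePerm_of_hom _ (fun s n ζ ζ' h l hl => ?_) s
  cases l with
  | zero => exact h 0 hl
  | succ j =>
    have key : BranchesAt y η j ζ ↔ BranchesAt y η j ζ' := by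
      unfold BranchesAt
      rw [h j (by omega)]
      refine and_congr_left fun _ => forall₂_congr fun l hl => ?_
      rw [h l (by omega)]
    simp only [betaPerm_apply, betaBoundary, h _ hl]
    classical exact if_congr key rfl rfl

/-! ### Germs -/

/-- Near `η`, the permutation `h` changes the tails of sequences as `betaPerm y η s` does. -/
def HasGerm (y : ∀ i, X i) (h : Equiv.Perm (∀ i, X i)) (η : ∀ i, X i) (s : ∀ i, G (i + 1)) :
    Prop :=
  ∃ N, ∀ ζ : ∀ i, X i, (∀ l < N, ζ l = η l) → ∀ i, N ≤ i → h ζ i = betaBoundary y η s ζ i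

variable {y : ∀ i, X i}

theorem hasGerm_one_iff {h : Equiv.Perm (∀ i, X i)} {η : ∀ i, X i} :
    HasGerm y h η (1 : ∀ i, G (i + 1)) ↔
      ∃ N, ∀ ζ : ∀ i, X i, (∀ l < N, ζ l = η l) → ∀ i, N ≤ i → h ζ i = ζ i := by
  simp only [HasGerm, betaBoundary_one]

theorem HasGerm.tail_eq {h : Equiv.Perm (∀ i, X i)} {η : ∀ i, X i} {s : ∀ i, G (i + 1)}
    (hs : HasGerm y h η s) : ∃ N, ∀ i, N ≤ i → h η i = η i := by
  obtain ⟨N, hN⟩ := hs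
  refine ⟨N, fun i hi => ?_⟩
  rw [hN η (fun _ _ => rfl) i hi, betaBoundary_self]

theorem HasGerm.mul {g h : Equiv.Perm (∀ i, X i)} {η : ∀ i, X i} {s t : ∀ i, G (i + 1)}
    (hh : h ∈ treePerm X) (hs : HasGerm y g (h η) s) (ht : HasGerm y h η t) :
    HasGerm y (g * h) η (s * t) := by
  obtain ⟨N₁, h₁⟩ := hs
  obtain ⟨N₂, h₂⟩ := ht
  refine ⟨max N₁ N₂, fun ζ hζ i hi => ?_⟩
  have hζ' := (hh _ ζ η).2 hζ
  rw [Equiv.Perm.mul_apply, h₁ _ (fun l hl => hζ' l (lt_max_of_lt_left hl)) i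
    (le_of_max_le_left hi), betaBoundary_mul]
  refine betaBoundary_congr s (N := max N₁ N₂) ((betaBoundary_agree_iff y η ζ t _).2 hζ) hζ'
    (fun i hi => ?_) (fun i hi => ?_) hi
  · exact h₂ _ (fun l hl => hζ l (lt_max_of_lt_right hl)) i (le_of_max_le_right hi)
  · rw [h₂ η (fun _ _ => rfl) i (le_of_max_le_right hi), betaBoundary_self]

theorem HasGerm.inv {h : Equiv.Perm (∀ i, X i)} {η : ∀ i, X i} {s : ∀ i, G (i + 1)}
    (hh : h ∈ treePerm X) (hs : HasGerm y h η s) : HasGerm y h⁻¹ (h η) s⁻¹ := by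
  obtain ⟨N, hN⟩ := hs
  refine ⟨N, fun ζ hζ i hi => ?_⟩
  obtain ⟨ξ, rfl⟩ := h.surjective ζ
  have hξ := (hh _ ξ η).1 hζ
  rw [← Equiv.Perm.mul_apply, inv_mul_cancel, Equiv.Perm.one_apply,
    betaBoundary_congr s⁻¹ (y := y) (η := η) (ζ := betaBoundary y η s ξ)
      ((betaBoundary_agree_iff y η ξ s _).2 hξ) hζ (fun i hi => hN ξ hξ i hi) (fun i hi => ?_) hi,
    ← betaBoundary_mul, inv_mul_cancel, betaBoundary_one]
  rw [hN η (fun _ _ => rfl) i hi, betaBoundary_self]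

theorem hasGerm_one_one (y η : ∀ i, X i) :
    HasGerm y 1 η (1 : ∀ i, G (i + 1)) :=
  hasGerm_one_iff.2 ⟨0, fun _ _ _ _ => rfl⟩

theorem HasGerm.mul_one_one {g h : Equiv.Perm (∀ i, X i)} {η : ∀ i, X i}
    (hh : h ∈ treePerm X) (hs : HasGerm y g (h η) (1 : ∀ i, G (i + 1)))
    (ht : HasGerm y h η (1 : ∀ i, G (i + 1))) : HasGerm y (g * h) η (1 : ∀ i, G (i + 1)) := by
  simpa using hs.mul hh ht

theorem HasGerm.inv_one {h : Equiv.Perm (∀ i, X i)} {η : ∀ i, X i}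
    (hh : h ∈ treePerm X) (hs : HasGerm y h η (1 : ∀ i, G (i + 1))) :
    HasGerm y h⁻¹ (h η) (1 : ∀ i, G (i + 1)) := by
  simpa using hs.inv hh

theorem hasGerm_alphaPerm (b : ∀ i, G i) (η : ∀ i, X i) :
    HasGerm y (alphaPerm b) η (1 : ∀ i, G (i + 1)) := by
  refine hasGerm_one_iff.2 ⟨1, fun ζ _ i hi => ?_⟩
  cases i with
  | zero => omega
  | succ i => rfl

theorem hasGerm_betaPerm_self (x : ∀ i, X i) (s : ∀ i, G (i + 1)) :
    HasGerm y (betaPerm y x s) x s :=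
  ⟨0, fun _ _ _ _ => rfl⟩

theorem hasGerm_betaPerm_of_ne {x η : ∀ i, X i} (s : ∀ i, G (i + 1)) (h : η ≠ x) :
    HasGerm y (betaPerm y x s) η (1 : ∀ i, G (i + 1)) := by
  obtain ⟨m, hm⟩ := Function.ne_iff.1 h
  -- Branching off `x` at `j` requires agreement with `x` before `j`. Sequences sharing the letter
  -- `m` with `η` can therefore only branch at `j ≤ m`, and the last letter affected is `m + 1`.
  refine hasGerm_one_iff.2 ⟨m + 2, fun ζ hζ i hi => ?_⟩
  cases i with
  | zero => omega
  | succ j =>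
    refine if_neg fun hj => hm ?_
    rw [← hζ m (by omega), hj.1 m (by omega)]

/-! ### Finitary permutations -/

/-- The tree permutations all of whose germs are trivial. -/
def finitaryPerm (G : ℕ → Type v) [∀ i, Group (G i)] [∀ i, MulAction (G i) (X i)]
    (y : ∀ i, X i) : Subgroup (Equiv.Perm (∀ i, X i)) where
  carrier := {h | h ∈ treePerm X ∧ ∀ η, HasGerm y h η (1 : ∀ i, G (i + 1))}
  one_mem' := ⟨one_mem _, fun η => hasGerm_one_one y η⟩
  mul_mem' := fun hg hh =>
    ⟨mul_mem hg.1 hh.1, fun η => (hg.2 _).mul_one_one hh.1 (hh.2 η)⟩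
  inv_mem' := fun {g} hg => ⟨inv_mem hg.1, fun η => by
    simpa using (hg.2 (g⁻¹ η)).inv_one hg.1⟩

/-- The tree permutations that change only the first `n` letters. -/
def levelPerm (X : ℕ → Type u) (n : ℕ) : Subgroup (Equiv.Perm (∀ i, X i)) where
  carrier := {h | h ∈ treePerm X ∧ ∀ ζ i, n ≤ i → h ζ i = ζ i}
  one_mem' := ⟨one_mem _, fun _ _ _ => rfl⟩
  mul_mem' := fun {g h} hg hh =>
    ⟨mul_mem hg.1 hh.1, fun ζ i hi => (hg.2 (h ζ) i hi).trans (hh.2 ζ i hi)⟩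
  inv_mem' := fun {g} hg => ⟨inv_mem hg.1, fun ζ i hi => by
    simpa using (hg.2 (g⁻¹ ζ) i hi).symm⟩

/-- An element is determined by its effect on prefixes of length `n`; `x` only serves to extend
these to sequences. -/
theorem finite_levelPerm [∀ i, Finite (X i)] (x : ∀ i, X i) (n : ℕ) : Finite (levelPerm X n) := by
  let ext : (∀ i : Fin n, X i) → ∀ i, X i := fun w i => if h : i < n then w ⟨i, h⟩ else x i
  let f : levelPerm X n → (∀ i : Fin n, X i) → ∀ i : Fin n, X i := fun h w i => h.1 (ext w) i
  refine Finite.of_injective f fun g h hgh => Subtype.ext (Equiv.ext fun ζ => funext fun i => ?_)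
  by_cases hi : i < n
  · have hζ : ∀ l < n, ζ l = ext (fun i => ζ i) l := fun l hl => by simp [ext, hl]
    have h1 := (g.2.1 n _ _).2 hζ i hi
    have h2 := (h.2.1 n _ _).2 hζ i hi
    rw [h1, h2]
    exact congrFun (congrFun hgh fun i => ζ i) ⟨i, hi⟩
  · rw [g.2.2 ζ i (not_lt.1 hi), h.2.2 ζ i (not_lt.1 hi)]

theorem levelPerm_mono {m n : ℕ} (h : m ≤ n) : levelPerm X m ≤ levelPerm X n :=
  fun _ hg => ⟨hg.1, fun ζ i hi => hg.2 ζ i (h.trans hi)⟩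

/-- Triviality of the germ at `η` gives a cylinder around `η` and a level from which no letter
changes on it. The boundary is compact, so finitely many cylinders cover it and one level serves for
all. -/
theorem exists_mem_levelPerm [∀ i, Finite (X i)] {h : Equiv.Perm (∀ i, X i)}
    (hh : h ∈ finitaryPerm G y) : ∃ n, h ∈ levelPerm X n := by
  let _ : ∀ i, TopologicalSpace (X i) := fun _ => ⊥
  have _ : ∀ i, DiscreteTopology (X i) := fun _ => ⟨rfl⟩
  have key := fun η => hasGerm_one_iff.1 (hh.2 η)
  choose N hN using key
  have hnhds : ∀ η : ∀ i, X i, {ζ : ∀ i, X i | ∀ l < N η, ζ l = η l} ∈ 𝓝 η := by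
    intro η
    have : {ζ : ∀ i, X i | ∀ l < N η, ζ l = η l} =
        Set.pi (Set.Iio (N η)) fun l => {η l} := by
      ext ζ
      simp [Set.mem_pi]
    rw [this]
    exact set_pi_mem_nhds (Set.finite_Iio _) fun l _ => by simp
  obtain ⟨t, -, ht⟩ := (isCompact_univ (X := ∀ i, X i)).elim_nhds_subcover _
    fun η _ => hnhds η
  refine ⟨t.sup N, hh.1, fun ζ i hi => ?_⟩
  obtain ⟨η, hη, hζ⟩ := Set.mem_iUnion₂.1 (ht (Set.mem_univ ζ))
  exact hN η ζ hζ i ((Finset.le_sup hη).trans hi)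

theorem isAmenableGroup_finitaryPerm [∀ i, Finite (X i)] (x : ∀ i, X i) :
    IsAmenableGroup (finitaryPerm G y) := by
  refine isAmenableGroup_of_locallyFinite fun F => ?_
  have key : ∀ h : finitaryPerm G y, ∃ n, h.1 ∈ levelPerm X n := fun h => exists_mem_levelPerm h.2
  choose N hN using key
  have hle : Subgroup.closure (F : Set (finitaryPerm G y)) ≤
      (levelPerm X (F.sup N)).comap (Subgroup.subtype _) := by
    rw [Subgroup.closure_le]
    exact fun h hF => levelPerm_mono (Finset.le_sup hF) (hN h)
  have := finite_levelPerm x (F.sup N)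
  refine Finite.of_injective (fun h : Subgroup.closure (F : Set (finitaryPerm G y)) =>
    (⟨h.1.1, hle h.2⟩ : levelPerm X (F.sup N))) fun g h hgh => ?_
  exact Subtype.ext (Subtype.ext (congrArg (fun z : levelPerm X (F.sup N) => z.1) hgh))

end Boundary

/-! ### The group generated on the boundary and its germs. -/

section BoundaryGroup

variable {X : ℕ → Type u} {G : ℕ → Type v} [∀ i, Group (G i)] [∀ i, MulAction (G i) (X i)]

/-- The group generated by the boundary maps of the `α` and the `β`. -/
noncomputable def boundaryGroup {k : ℕ} (a : ∀ i, Fin k → G i) (x y : ∀ i, X i) :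
    Subgroup (Equiv.Perm (∀ i, X i)) :=
  Subgroup.closure
    (Set.range (fun j : Fin k => alphaPerm (X := X) fun i => a i j) ∪
      Set.range (fun j : Fin k => betaPerm y x fun i => a (i + 1) j))

variable {k : ℕ} {a : ∀ i, Fin k → G i} {x y : ∀ i, X i}

theorem boundaryGroup_le_treePerm : boundaryGroup a x y ≤ treePerm X := by
  rw [boundaryGroup, Subgroup.closure_le]
  rintro _ (⟨j, rfl⟩ | ⟨j, rfl⟩)
  · exact alphaPerm_mem_treePerm _
  · exact betaPerm_mem_treePerm _ _ _

theorem exists_hasGerm {h : Equiv.Perm (∀ i, X i)} (hh : h ∈ boundaryGroup a x y) :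
    ∀ η, ∃ s ∈ sequenceGroup a, HasGerm y h η s := by
  induction hh using Subgroup.closure_induction with
  | mem h hh =>
    intro η
    rcases hh with ⟨j, rfl⟩ | ⟨j, rfl⟩
    · exact ⟨1, one_mem _, hasGerm_alphaPerm _ η⟩
    · by_cases hη : η = x
      · subst hη
        exact ⟨_, Subgroup.subset_closure ⟨j, rfl⟩, hasGerm_betaPerm_self η _⟩
      · exact ⟨1, one_mem _, hasGerm_betaPerm_of_ne _ hη⟩
  | one => exact fun η => ⟨1, one_mem _, hasGerm_one_one y η⟩
  | mul g h _ hh ihg ihh =>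
    intro η
    obtain ⟨t, ht, ht'⟩ := ihh η
    obtain ⟨s, hs, hs'⟩ := ihg (h η)
    exact ⟨s * t, mul_mem hs ht, hs'.mul (boundaryGroup_le_treePerm hh) ht'⟩
  | inv h hh ih =>
    intro η
    obtain ⟨s, hs, hs'⟩ := ih (h⁻¹ η)
    refine ⟨s⁻¹, inv_mem hs, ?_⟩
    simpa using hs'.inv (boundaryGroup_le_treePerm hh)

/-- The sequences that are cofinal with `x`. -/
def cofinal (x : ∀ i, X i) : Set (∀ i, X i) := {η | ∃ n, ∀ i, n ≤ i → η i = x i}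

theorem cofinal_of_tail_eq {η ζ : ∀ i, X i} (h : ∃ N, ∀ i, N ≤ i → η i = ζ i)
    (hζ : ζ ∈ cofinal x) : η ∈ cofinal x := by
  obtain ⟨N, hN⟩ := h
  obtain ⟨M, hM⟩ := hζ
  exact ⟨max N M, fun i hi => (hN i (le_of_max_le_left hi)).trans (hM i (le_of_max_le_right hi))⟩

/-- The exceptional set of `g * h` is contained in that of `h` together with the preimage under `h`
of that of `g`. It stays cofinal with `x` because an element of the group changes only finitely many
letters of any one sequence. -/
theorem exists_finset_hasGerm_one {h : Equiv.Perm (∀ i, X i)} (hh : h ∈ boundaryGroup a x y) :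
    ∃ E : Finset (∀ i, X i), (E : Set (∀ i, X i)) ⊆ cofinal x ∧
      ∀ η, η ∉ E → HasGerm y h η (1 : ∀ i, G (i + 1)) := by
  classical
  have tail : ∀ h ∈ boundaryGroup a x y, ∀ η, ∃ N, ∀ i, N ≤ i → h η i = η i := fun h hh η =>
    let ⟨_, _, hs⟩ := exists_hasGerm hh η
    hs.tail_eq
  induction hh using Subgroup.closure_induction with
  | mem h hh =>
    rcases hh with ⟨j, rfl⟩ | ⟨j, rfl⟩
    · exact ⟨∅, by simp, fun η _ => hasGerm_alphaPerm _ η⟩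
    · refine ⟨{x}, ?_, fun η hη => hasGerm_betaPerm_of_ne _ (by simpa using hη)⟩
      rw [Finset.coe_singleton, Set.singleton_subset_iff]
      exact ⟨0, fun _ _ => rfl⟩
  | one => exact ⟨∅, by simp, fun η _ => hasGerm_one_one y η⟩
  | mul g h hg hh ihg ihh =>
    obtain ⟨E, hE, hE'⟩ := ihg
    obtain ⟨F, hF, hF'⟩ := ihh
    refine ⟨F ∪ E.image h.symm, ?_, fun η hη => ?_⟩
    · rw [Finset.coe_union, Set.union_subset_iff, Finset.coe_image, Set.image_subset_iff]
      exact ⟨hF, fun η hη => cofinal_of_tail_eq (tail h⁻¹ (inv_mem hh) η) (hE hη)⟩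
    · rw [Finset.mem_union, not_or] at hη
      refine (hE' _ fun h' => hη.2 ?_).mul_one_one (boundaryGroup_le_treePerm hh) (hF' _ hη.1)
      exact Finset.mem_image.2 ⟨_, h', by simp⟩
  | inv h hh ih =>
    obtain ⟨E, hE, hE'⟩ := ih
    refine ⟨E.image h, ?_, fun η hη => ?_⟩
    · rw [Finset.coe_image, Set.image_subset_iff]
      exact fun η hη => cofinal_of_tail_eq (tail h hh η) (hE hη)
    · have h1 := (hE' (h⁻¹ η) fun h' => hη
        (Finset.mem_image.2 ⟨_, h', by simp⟩)).inv_one (boundaryGroup_le_treePerm hh)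
      simpa using h1

/-! ### Recurrence -/

open Classical in
/-- A function on the boundary decreasing slowly from `π / 2` to `0` along the filtration of the
sequences cofinal with `x` by the length of the part that differs from `x`. -/
noncomputable def ramp (x : ∀ i, X i) (n : ℕ) (η : ∀ i, X i) : ℝ :=
  Real.pi / (2 * n) * ∑ m ∈ Finset.Ico n (2 * n), if ∀ i, m ≤ i → η i = x i then 1 else 0

theorem finite_support_ramp [∀ i, Finite (X i)] (x : ∀ i, X i) (n : ℕ) :
    (Function.support (ramp x n)).Finite := by
  refine Set.Finite.subset (s := {η | ∀ i, 2 * n ≤ i → η i = x i}) ?_ fun η hη => ?_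
  · refine Set.Finite.of_injOn (f := fun (η : ∀ i, X i) (i : Fin (2 * n)) => η i)
      (t := Set.univ) (fun _ _ => trivial) (fun η hη ζ hζ h => funext fun i => ?_)
      (Set.toFinite _)
    by_cases hi : i < 2 * n
    · exact congrFun h ⟨i, hi⟩
    · rw [hη i (not_lt.1 hi), hζ i (not_lt.1 hi)]
  · by_contra h
    refine hη ?_
    unfold ramp
    rw [Finset.sum_eq_zero, mul_zero]
    intro m hm
    refine if_neg fun hm' => h fun i hi => hm' i ?_
    rw [Finset.mem_Ico] at hm
    omega

theorem eventually_ramp_eq {η : ∀ i, X i} (hη : η ∈ cofinal x) :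
    ∀ᶠ n in atTop, ramp x n η = Real.pi / 2 := by
  obtain ⟨N, hN⟩ := hη
  filter_upwards [eventually_ge_atTop N, eventually_gt_atTop 0] with n hn hn0
  unfold ramp
  rw [Finset.sum_congr rfl (g := fun _ => (1 : ℝ))]
  · have : (n : ℝ) ≠ 0 := by exact_mod_cast hn0.ne'
    rw [Finset.sum_const, Nat.card_Ico, show 2 * n - n = n by omega, nsmul_eq_mul]
    field_simp
  · intro m hm
    rw [Finset.mem_Ico] at hm
    exact if_pos fun i hi => hN i (by omega)

theorem ramp_alphaPerm (b : ∀ i, G i) (n : ℕ) (η : ∀ i, X i) :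
    ramp x n (alphaPerm b η) = ramp x n η := by
  unfold ramp
  congr 1
  refine Finset.sum_congr rfl fun m hm => ?_
  rw [Finset.mem_Ico] at hm
  have key : (∀ i, m ≤ i → alphaPerm b η i = x i) ↔ ∀ i, m ≤ i → η i = x i := by
    refine forall₂_congr fun i hi => ?_
    cases i with
    -- The only letter that `α` moves has index `0`, and `m = 0` is impossible when `n ≤ m < 2 * n`.
    | zero => omega
    | succ i => rfl
  classical exact if_congr key rfl rfl

/-- Only letter `i + 1` is altered. Tails starting at `m ≤ i` contain the disagreement with `x` at
`i`, before and after; tails starting at `m ≥ i + 2` do not see the altered letter. -/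
theorem tail_betaPerm_iff (s : ∀ i, G (i + 1)) {η : ∀ i, X i} {i : ℕ}
    (hi : BranchesAt y x i η) {m : ℕ} (hm : m ≠ i + 1) :
    (∀ l, m ≤ l → betaPerm y x s η l = x l) ↔ ∀ l, m ≤ l → η l = x l := by
  by_cases h : m ≤ i
  · refine iff_of_false (fun H => ?_) (fun H => hi.2.1 (H i h))
    exact ((branchesAt_betaBoundary_iff y x η s i).2 hi).2.1 (H i h)
  · refine forall₂_congr fun l hl => ?_
    obtain ⟨l, rfl⟩ : ∃ l', l = l' + 1 := ⟨l - 1, by omega⟩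
    have : ¬ BranchesAt y x l η := fun H => hi.2.1 (H.1 i (by omega))
    rw [betaPerm_apply, betaBoundary, if_neg this]

theorem eq_update_of_branchesAt {η : ∀ i, X i} {i : ℕ} (hi : BranchesAt y x i η)
    (h : ∀ l, i + 1 ≤ l → η l = x l) : η = Function.update x i (y i) := by
  funext l
  rcases lt_trichotomy l i with hl | rfl | hl
  · rw [Function.update_of_ne hl.ne, hi.1 l hl]
  · rw [Function.update_self, hi.2.2]
  · rw [Function.update_of_ne hl.ne', h l hl]

/-- If `η` branches off at `i`, only the summand `m = i + 1` can change, which bounds the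
difference. If it does change, `η` or its image follows `x` again after `i`, hence is `x` with one
letter replaced. -/
theorem ramp_betaPerm (s : ∀ i, G (i + 1)) (n : ℕ) (η : ∀ i, X i) :
    |ramp x n η - ramp x n (betaPerm y x s η)| ≤ Real.pi / (2 * n) ∧
    (ramp x n η ≠ ramp x n (betaPerm y x s η) → ∃ i < 2 * n,
      η = Function.update x i (y i) ∨ betaPerm y x s η = Function.update x i (y i)) := by
  classical
  have hpos : 0 ≤ Real.pi / (2 * n) := by positivity
  by_cases hη : ∃ i, BranchesAt y x i η
  · obtain ⟨i, hi⟩ := hη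
    have hi' := (branchesAt_betaBoundary_iff y x η s i).2 hi
    constructor
    · unfold ramp
      rw [← mul_sub, ← Finset.sum_sub_distrib, abs_mul, abs_of_nonneg hpos]
      refine mul_le_of_le_one_right hpos ((Finset.abs_sum_le_sum_abs _ _).trans ?_)
      refine (Finset.sum_le_sum (g := fun m => if m = i + 1 then (1 : ℝ) else 0)
        fun m _ => ?_).trans ?_
      · by_cases hm : m = i + 1
        · rw [if_pos hm]
          split_ifs <;> simp
        · simp [tail_betaPerm_iff s hi hm, hm]
      · rw [Finset.sum_ite_eq']
        split_ifs <;> simp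
    · intro hne
      have h1 : i + 1 ∈ Finset.Ico n (2 * n) ∧
          ((∀ l, i + 1 ≤ l → η l = x l) ∨ ∀ l, i + 1 ≤ l → betaPerm y x s η l = x l) := by
        by_contra H
        refine hne ?_
        unfold ramp
        congr 1
        refine Finset.sum_congr rfl fun m hm => ?_
        by_cases hmi : m = i + 1
        · subst hmi
          have h2 := not_or.1 (not_and.1 H hm)
          rw [if_neg h2.1, if_neg h2.2]
        · simp only [tail_betaPerm_iff s hi hmi]
      refine ⟨i, by have := Finset.mem_Ico.1 h1.1; omega, h1.2.imp ?_ ?_⟩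
      · exact eq_update_of_branchesAt hi
      · exact eq_update_of_branchesAt hi'
  · have : betaPerm y x s η = η := by
      funext l
      cases l with
      | zero => rfl
      | succ l => exact if_neg fun h => hη ⟨l, h⟩
    rw [this]
    simp [hpos]

/-- At most `4 * n` points contribute, two for each `i < 2 * n`, and each contributes at most `(π /
(2 * n))²`. -/
theorem sum_ramp_betaPerm_le (s : ∀ i, G (i + 1)) (n : ℕ)
    (U : Finset (∀ i, X i)) :
    ∑ η ∈ U, (ramp x n η - ramp x n (betaPerm y x s η)) ^ 2 ≤ Real.pi ^ 2 / n := by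
  classical
  let p : ℕ → ∀ i, X i := fun i => Function.update x i (y i)
  let B : Finset (∀ i, X i) := (Finset.range (2 * n)).image p ∪
    (Finset.range (2 * n)).image fun i => (betaPerm y x s).symm (p i)
  have hB : (B.card : ℝ) ≤ 4 * n := by
    have h1 : B.card ≤ _ := Finset.card_union_le ((Finset.range (2 * n)).image p)
      ((Finset.range (2 * n)).image fun i => (betaPerm y x s).symm (p i))
    have h2 := Finset.card_image_le (s := Finset.range (2 * n)) (f := p)
    have h3 := Finset.card_image_le (s := Finset.range (2 * n))
      (f := fun i => (betaPerm y x s).symm (p i))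
    rw [Finset.card_range] at h2 h3
    exact_mod_cast (show B.card ≤ 4 * n by omega)
  have h1 : ∀ η ∈ U, (ramp x n η - ramp x n (betaPerm y x s η)) ^ 2 ≤
      if η ∈ B then (Real.pi / (2 * n)) ^ 2 else 0 := by
    intro η _
    obtain ⟨h2, h3⟩ := ramp_betaPerm s n η
    by_cases hη : η ∈ B
    · rw [if_pos hη, ← sq_abs]
      exact pow_le_pow_left₀ (abs_nonneg _) h2 2
    · rw [if_neg hη]
      have : ramp x n η = ramp x n (betaPerm y x s η) := by
        by_contra hne
        obtain ⟨i, hi, hi'⟩ := h3 hne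
        refine hη (Finset.mem_union.2 (hi'.imp (fun h => ?_) fun h => ?_))
        · exact Finset.mem_image.2 ⟨i, Finset.mem_range.2 hi, h.symm⟩
        · exact Finset.mem_image.2 ⟨i, Finset.mem_range.2 hi, (Equiv.symm_apply_eq _).2 h.symm⟩
      rw [this]
      simp
  refine (Finset.sum_le_sum h1).trans ?_
  rw [← Finset.sum_filter, Finset.sum_const, nsmul_eq_mul]
  have h4 : ((U.filter (· ∈ B)).card : ℝ) ≤ 4 * n := by
    refine le_trans ?_ hB
    exact_mod_cast Finset.card_le_card fun η hη => (Finset.mem_filter.1 hη).2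
  refine (mul_le_mul_of_nonneg_right h4 (sq_nonneg _)).trans (le_of_eq ?_)
  -- For `n = 0` both sides vanish, division by zero being zero.
  rcases eq_or_ne (n : ℝ) 0 with hn | hn
  · simp [hn]
  · field_simp
    ring

open scoped Pointwise in
/-- The action of the boundary group on the cofinality class of `x` is extensively amenable. -/
theorem exists_isInvariantMean_finset_boundary [∀ i, Finite (X i)] [DecidableEq (∀ i, X i)] :
    ∃ ν, IsInvariantMean (boundaryGroup a x y) (Finset (∀ i, X i)) ν ∧
      ∀ E₀ : Finset (∀ i, X i), (E₀ : Set (∀ i, X i)) ⊆ cofinal x → ν {E | E₀ ⊆ E} = 1 := by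
  refine exists_isInvariantMean_finset _ (Subgroup.closure_closure_coe_preimage (k :=
    Set.range (fun j : Fin k => alphaPerm (X := X) fun i => a i j) ∪
      Set.range (fun j : Fin k => betaPerm y x fun i => a (i + 1) j))) (ramp x)
    (finite_support_ramp x) (fun _ n => Real.pi ^ 2 / n) (fun _ _ => ?_) ?_ (cofinal x)
    (fun η hη => eventually_ramp_eq hη)
  · exact tendsto_const_nhds.div_atTop tendsto_natCast_atTop_atTop
  · rintro ⟨g, hg'⟩ (⟨j, hj⟩ | ⟨j, hj⟩) n U
    · have hj' : g = alphaPerm fun i => a i j := hj.symm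
      subst hj'
      refine (Finset.sum_eq_zero fun η _ => ?_).trans_le (by positivity)
      have : ramp x n ((⟨_, hg'⟩ : boundaryGroup a x y) • η) = ramp x n η := ramp_alphaPerm _ n η
      exact (sq_eq_zero_iff.2 (sub_eq_zero.2 this.symm))
    · have hj' : g = betaPerm y x fun i => a (i + 1) j := hj.symm
      subst hj'
      exact sum_ramp_betaPerm_le _ n U

/-! ### Amenability of the boundary group -/

/-- The elements of the boundary group fixing all points of `E` and with trivial germs
elsewhere. -/
def pointStabilizer (a : ∀ i, Fin k → G i) (x y : ∀ i, X i) (E : Finset (∀ i, X i)) :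
    Subgroup (Equiv.Perm (∀ i, X i)) where
  carrier := {h | h ∈ boundaryGroup a x y ∧ (∀ η ∈ E, h η = η) ∧
    ∀ η, η ∉ E → HasGerm y h η (1 : ∀ i, G (i + 1))}
  one_mem' := ⟨one_mem _, fun _ _ => rfl, fun η _ => hasGerm_one_one y η⟩
  mul_mem' := by
    rintro g h ⟨hg, hg1, hg2⟩ ⟨hh, hh1, hh2⟩
    refine ⟨mul_mem hg hh, fun η hη => ?_, fun η hη => ?_⟩
    · rw [Equiv.Perm.mul_apply, hh1 η hη, hg1 η hη]
    · refine (hg2 _ fun h' => hη ?_).mul_one_one (boundaryGroup_le_treePerm hh) (hh2 η hη)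
      rwa [← h.injective (hh1 _ h')]
  inv_mem' := by
    rintro h ⟨hh, hh1, hh2⟩
    refine ⟨inv_mem hh, fun η hη => ?_, fun η hη => ?_⟩
    · rw [Equiv.Perm.inv_eq_iff_eq, hh1 η hη]
    · have h1 := (hh2 (h⁻¹ η) fun h' => hη ?_).inv_one (boundaryGroup_le_treePerm hh)
      · simpa using h1
      · have := hh1 _ h'
        rw [← Equiv.Perm.mul_apply, mul_inv_cancel, Equiv.Perm.one_apply] at this
        rwa [this]

/-- Pairs of an element of `pointStabilizer a x y E` and a family of its germs on `E`. -/
def germPairs (a : ∀ i, Fin k → G i) (x y : ∀ i, X i) (E : Finset (∀ i, X i)) :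
    Subgroup (Equiv.Perm (∀ i, X i) × (E → sequenceGroup a)) where
  carrier := {q | q.1 ∈ pointStabilizer a x y E ∧ ∀ η : E, HasGerm y q.1 η (q.2 η).1}
  one_mem' := ⟨one_mem _, fun η => hasGerm_one_one y η.1⟩
  mul_mem' := by
    rintro p q ⟨hp, hp'⟩ ⟨hq, hq'⟩
    refine ⟨mul_mem hp hq, fun η => HasGerm.mul (boundaryGroup_le_treePerm hq.1) ?_ (hq' η)⟩
    rw [hq.2.1 η η.2]
    exact hp' η
  inv_mem' := by
    rintro p ⟨hp, hp'⟩
    refine ⟨inv_mem hp, fun η => ?_⟩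
    have := (hp' η).inv (boundaryGroup_le_treePerm hp.1)
    rwa [hp.2.1 η η.2] at this

/-- A pair whose recorded germs are all `1` has trivial germs on `E` as well as off `E`, so its
permutation is finitary. -/
theorem isAmenableGroup_germPairs [∀ i, Finite (X i)] (hS : IsAmenableGroup (sequenceGroup a))
    (E : Finset (∀ i, X i)) : IsAmenableGroup (germPairs a x y E) := by
  let f : E → germPairs a x y E →* sequenceGroup a := fun η =>
    (Pi.evalMonoidHom (fun _ : E => sequenceGroup a) η).comp
      ((MonoidHom.snd _ _).comp (Subgroup.subtype _))
  refine isAmenableGroup_of_iInf_ker f ?_ hS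
  have hmem : ∀ q : (⨅ η, (f η).ker : Subgroup (germPairs a x y E)), ∀ η, q.1.1.2 η = 1 :=
    fun q η => (Subgroup.mem_iInf.1 q.2 η : _)
  let φ : (⨅ η, (f η).ker : Subgroup (germPairs a x y E)) →* finitaryPerm G y :=
    { toFun := fun q => ⟨q.1.1.1, boundaryGroup_le_treePerm q.1.2.1.1, fun η => by
        by_cases hη : η ∈ E
        · have := q.1.2.2 ⟨η, hη⟩
          rwa [hmem q] at this
        · exact q.1.2.1.2.2 η hη⟩
      map_one' := rfl
      map_mul' := fun _ _ => rfl }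
  refine isAmenableGroup_of_injective φ (fun p q hpq => ?_) (isAmenableGroup_finitaryPerm x)
  refine Subtype.ext (Subtype.ext (Prod.ext ?_ ?_))
  · exact congrArg (fun z : finitaryPerm G y => z.1) hpq
  · funext η
    rw [hmem p, hmem q]

/-- `HasGerm` does not determine the sequence, since early terms are irrelevant. Instead of a
homomorphism sending an element to its germs, the group of pairs is used, which maps onto the
stabilizer because germs exist at every point. -/
theorem isAmenableGroup_pointStabilizer [∀ i, Finite (X i)]
    (hS : IsAmenableGroup (sequenceGroup a)) (E : Finset (∀ i, X i)) :
    IsAmenableGroup (pointStabilizer a x y E) := by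
  let f : germPairs a x y E →* pointStabilizer a x y E :=
    { toFun := fun q => ⟨q.1.1, q.2.1⟩
      map_one' := rfl
      map_mul' := fun _ _ => rfl }
  refine isAmenableGroup_of_surjective f (fun h => ?_) (isAmenableGroup_germPairs hS E)
  choose s hs hs' using exists_hasGerm h.2.1
  exact ⟨⟨(h.1, fun η => ⟨s η, hs η⟩), h.2, fun η => hs' η⟩, rfl⟩

-- An element is good at `E` when its germs off `E` are trivial. Almost every `E` contains the
-- finite exceptional set of a given element, hence is good for it. The good stabilizer of `E`
-- permutes `E`, and the kernel of this finite action embeds in `pointStabilizer`.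
open scoped Pointwise in
theorem isAmenableGroup_boundaryGroup [∀ i, Finite (X i)]
    (hS : IsAmenableGroup (sequenceGroup a)) : IsAmenableGroup (boundaryGroup a x y) := by
  classical
  obtain ⟨ν, hν, hν1⟩ := exists_isInvariantMean_finset_boundary (a := a) (x := x) (y := y)
  refine isAmenableGroup_of_good hν
    (fun h E => ∀ η, η ∉ E → HasGerm y h.1 η (1 : ∀ i, G (i + 1)))
    (fun E η _ => hasGerm_one_one y η) ?_ ?_ ?_ ?_
  · intro g h E hh hg η hη
    refine (hg _ fun h' => hη ?_).mul_one_one (boundaryGroup_le_treePerm h.2) (hh η hη)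
    exact (Finset.smul_mem_smul_finset_iff h).1 h'
  · intro g E hg η hη
    have h1 := (hg (g⁻¹ • η) fun h' => hη (Finset.inv_smul_mem_iff.1 h')).inv_one
      (boundaryGroup_le_treePerm g.2)
    have h2 : g.1 (g⁻¹ • η) = η := smul_inv_smul g η
    rwa [h2] at h1
  · intro g
    obtain ⟨E₀, hE₀, hE₀'⟩ := exists_finset_hasGerm_one g.2
    refine le_antisymm (hν.mem_Icc _).2 ?_
    rw [← hν1 E₀ hE₀]
    exact hν.isMean.mono fun E hE η hη => hE₀' η fun h => hη (hE h)
  · intro E H hH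
    have hE : ∀ h : H, ∀ η, h.1.1 η ∈ E ↔ η ∈ E := by
      intro h η
      have := Finset.smul_mem_smul_finset_iff (s := E) (b := η) h.1
      rwa [((hH h.1).1 h.2).1] at this
    let f : H →* Equiv.Perm {η // η ∈ E} :=
      { toFun := fun h => h.1.1.subtypePerm (hE h)
        map_one' := rfl
        map_mul' := fun _ _ => rfl }
    refine isAmenableGroup_of_ker f ?_ (isAmenableGroup_of_finite _)
    let φ : f.ker →* pointStabilizer a x y E :=
      { toFun := fun h => ⟨h.1.1.1, h.1.1.2, fun η hη =>
          congrArg Subtype.val (Equiv.congr_fun h.2 ⟨η, hη⟩), ((hH _).1 h.1.2).2⟩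
        map_one' := rfl
        map_mul' := fun _ _ => rfl }
    refine isAmenableGroup_of_injective φ (fun p q hpq => ?_) (isAmenableGroup_pointStabilizer hS E)
    exact Subtype.ext (Subtype.ext (Subtype.ext
      (congrArg (fun z : pointStabilizer a x y E => z.1) hpq)))

/-- The sequence group embeds into the boundary group. -/
theorem isAmenableGroup_sequenceGroup [∀ i, FaithfulSMul (G i) (X i)] (hxy : ∀ i, x i ≠ y i)
    (hΓ : IsAmenableGroup (boundaryGroup a x y)) : IsAmenableGroup (sequenceGroup a) := by
  have hle : sequenceGroup a ≤ (boundaryGroup a x y).comap (betaPerm y x) := by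
    rw [sequenceGroup, Subgroup.closure_le]
    rintro _ ⟨j, rfl⟩
    exact Subgroup.subset_closure (Or.inr ⟨j, rfl⟩)
  let f : sequenceGroup a →* boundaryGroup a x y :=
    ((betaPerm y x).comp (Subgroup.subtype _)).codRestrict _ fun s => hle s.2
  refine isAmenableGroup_of_injective f (fun s t hst => ?_) hΓ
  refine Subtype.ext (funext fun i => eq_of_smul_eq_smul fun z : X (i + 1) => ?_)
  -- A sequence that leaves `x` at `i` through `y i` and continues with `z`: the `i`-th term acts on
  -- precisely this `z`.
  let ζ : ∀ l, X l := Function.update (Function.update x i (y i)) (i + 1) z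
  have hζ : BranchesAt y x i ζ := by
    have hi : ζ i = y i := by simp [ζ]
    refine ⟨fun l hl => ?_, hi ▸ (hxy i).symm, hi⟩
    simp only [ζ]
    rw [Function.update_of_ne (by omega), Function.update_of_ne (by omega)]
  have h1 : betaBoundary y x s.1 ζ (i + 1) = betaBoundary y x t.1 ζ (i + 1) :=
    congrFun (Equiv.congr_fun (congrArg Subtype.val hst) ζ) (i + 1)
  simpa [betaBoundary, hζ, ζ] using h1

end BoundaryGroup

/-! ### From the boundary to the tree -/

section Tree

variable {X : ℕ → Type u} {G : ℕ → Type v} [∀ i, Group (G i)] [∀ i, MulAction (G i) (X i)]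

/-- The word `ζ i, …, ζ (i + n - 1)`. -/
def factorWord (ζ : ∀ i, X i) : ∀ (_ i : ℕ), Word X i
  | 0, _ => Word.nil
  | n + 1, i => Word.cons (ζ i) (factorWord ζ n (i + 1))

theorem factorWord_congr {ζ ζ' : ∀ i, X i} (n i : ℕ) (h : ∀ l, i ≤ l → ζ l = ζ' l) :
    factorWord ζ n i = factorWord ζ' n i := by
  induction n generalizing i with
  | zero => rfl
  | succ n ih => rw [factorWord, factorWord, h i le_rfl, ih _ fun l hl => h l (by omega)]

theorem apply_eq_of_factorWord_eq {ζ ζ' : ∀ i, X i} {n i : ℕ}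
    (h : factorWord ζ n i = factorWord ζ' n i) : ∀ l, i ≤ l → l < i + n → ζ l = ζ' l := by
  induction n generalizing i with
  | zero => intro l hl hl'; omega
  | succ n ih =>
    intro l hl hl'
    rw [factorWord, factorWord] at h
    injection h with h1 h2 h3
    rcases hl.eq_or_lt with rfl | hl
    · exact h2
    · exact ih h3 l hl (by omega)

theorem exists_eq_factorWord (x : ∀ i, X i) {i : ℕ} (w : Word X i) :
    ∃ ζ n, w = factorWord ζ n i := by
  induction w with
  | nil => exact ⟨x, 0, rfl⟩
  | @cons i z w ih =>
    obtain ⟨ζ, n, rfl⟩ := ih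
    refine ⟨Function.update ζ i z, n + 1, ?_⟩
    rw [factorWord, Function.update_self,
      factorWord_congr n (i + 1) fun l hl =>
        (Function.update_of_ne (show l ≠ i by omega) _ _).symm]

theorem alphaFun_factorWord (b : ∀ i, G i) (ζ : ∀ i, X i) (n i : ℕ) :
    alphaFun b (factorWord ζ n i) = factorWord (Function.update ζ i (b i • ζ i)) n i := by
  cases n with
  | zero => rfl
  | succ n =>
    rw [factorWord, factorWord, Function.update_self, alphaFun,
      factorWord_congr n (i + 1) fun l hl =>
        (Function.update_of_ne (show l ≠ i by omega) _ _).symm]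

/-- The part of the sequence already read follows `x`, so whether it branches at `i` is decided by
the letter `ζ i` alone. The starting index has to move in the induction. -/
theorem betaFun_factorWord (b : ∀ i, G i) {x y : ∀ i, X i} (ζ : ∀ i, X i) (n i : ℕ)
    (h : ∀ l < i, ζ l = x l) :
    betaFun b x y (factorWord ζ n i) =
      factorWord (betaBoundary y x (fun l => b (l + 1)) ζ) n i := by
  induction n generalizing i with
  | zero => rfl
  | succ n ih =>
    rw [factorWord, factorWord, betaBoundary_apply_of_agree y _ h le_rfl, betaFun]
    by_cases hx : ζ i = x i
    · rw [if_pos hx, ih (i + 1) (Nat.forall_lt_succ_right.2 ⟨h, hx⟩)]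
    · rw [if_neg hx]
      have hne : ∀ l, i + 1 ≤ l → ¬ BranchesAt y x l ζ := fun l hl H => hx (H.1 i hl)
      by_cases hy : ζ i = y i
      · rw [if_pos hy, alphaFun_factorWord]
        congr 1
        refine factorWord_congr _ _ fun l hl => ?_
        obtain ⟨l, rfl⟩ : ∃ l', l = l' + 1 := ⟨l - 1, by omega⟩
        rcases (Nat.succ_le_succ_iff.1 hl).eq_or_lt with rfl | hl
        · rw [Function.update_self, betaBoundary, if_pos ⟨h, hx, hy⟩]
        · rw [Function.update_of_ne (by omega), betaBoundary, if_neg (hne l hl)]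
      · rw [if_neg hy]
        congr 1
        refine factorWord_congr _ _ fun l hl => ?_
        obtain ⟨l, rfl⟩ : ∃ l', l = l' + 1 := ⟨l - 1, by omega⟩
        rw [betaBoundary, if_neg fun H => ?_]
        rcases (Nat.succ_le_succ_iff.1 hl).eq_or_lt with rfl | hl
        · exact hy H.2.2
        · exact hne l hl H

/-- The pairs of a tree automorphism and a permutation of the boundary that induce the same
action on prefixes. -/
def compatiblePairs (X : ℕ → Type u) : Subgroup (TreeAut X 0 × Equiv.Perm (∀ i, X i)) where
  carrier := {q | ∀ ζ n, q.1 (factorWord ζ n 0) = factorWord (q.2 ζ) n 0}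
  one_mem' := fun _ _ => rfl
  mul_mem' := by
    intro p q hp hq ζ n
    exact (congrArg p.1 (hq ζ n)).trans (hp _ n)
  inv_mem' := by
    intro p hp ζ n
    have h1 := hp (p.2⁻¹ ζ) n
    rw [← Equiv.Perm.mul_apply, mul_inv_cancel, Equiv.Perm.one_apply] at h1
    change p.1.symm (factorWord ζ n 0) = _
    rw [← h1, RelIso.symm_apply_apply]
    rfl

/-- The group generated by the `α` and the `β` acting both on the tree and on the boundary. -/
noncomputable def pairGroup {k : ℕ} (a : ∀ i, Fin k → G i) (x y : ∀ i, X i) :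
    Subgroup (TreeAut X 0 × Equiv.Perm (∀ i, X i)) :=
  Subgroup.closure
    (Set.range (fun j : Fin k => (alpha (X := X) (fun i => a i j) 0, alphaPerm fun i => a i j)) ∪
      Set.range (fun j : Fin k =>
        (beta (fun i => a i j) x y 0, betaPerm y x fun i => a (i + 1) j)))

variable {k : ℕ} {a : ∀ i, Fin k → G i} {x y : ∀ i, X i}

theorem pairGroup_le : pairGroup a x y ≤ compatiblePairs X := by
  rw [pairGroup, Subgroup.closure_le]
  rintro _ (⟨j, rfl⟩ | ⟨j, rfl⟩) ζ n
  · refine (alphaFun_factorWord _ ζ n 0).trans (factorWord_congr _ _ fun l _ => ?_)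
    cases l with
    | zero => rw [Function.update_self]; rfl
    | succ l => rw [Function.update_of_ne (by omega)]; rfl
  · exact betaFun_factorWord _ ζ n 0 (by simp)

theorem map_fst_pairGroup : (pairGroup a x y).map (MonoidHom.fst _ _) = segalGroup a x y := by
  rw [pairGroup, MonoidHom.map_closure, Set.image_union, ← Set.range_comp, ← Set.range_comp]
  rfl

theorem map_snd_pairGroup : (pairGroup a x y).map (MonoidHom.snd _ _) = boundaryGroup a x y := by
  rw [pairGroup, MonoidHom.map_closure, Set.image_union, ← Set.range_comp, ← Set.range_comp]
  rfl

/-- `pairGroup` is the graph of an isomorphism: a sequence is determined by its prefixes and every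
word is a prefix, so both projections are injective. -/
theorem isAmenableGroup_segalGroup_iff_boundaryGroup :
    IsAmenableGroup (segalGroup a x y) ↔ IsAmenableGroup (boundaryGroup a x y) := by
  rw [← map_fst_pairGroup, ← map_snd_pairGroup]
  have hle := pairGroup_le (a := a) (x := x) (y := y)
  constructor
  · intro h
    refine isAmenableGroup_of_surjective _ (MonoidHom.subgroupMap_surjective _ _)
      (isAmenableGroup_of_injective ((MonoidHom.fst _ _).subgroupMap (pairGroup a x y)) ?_ h)
    intro p q hpq
    have h1 : p.1.1 = q.1.1 := congrArg Subtype.val hpq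
    refine Subtype.ext (Prod.ext h1 (Equiv.ext fun ζ => funext fun l => ?_))
    refine apply_eq_of_factorWord_eq (n := l + 1) (i := 0) ?_ l (by omega) (by omega)
    rw [← hle p.2, ← hle q.2, h1]
  · intro h
    refine isAmenableGroup_of_surjective _ (MonoidHom.subgroupMap_surjective _ _)
      (isAmenableGroup_of_injective ((MonoidHom.snd _ _).subgroupMap (pairGroup a x y)) ?_ h)
    intro p q hpq
    have h1 : p.1.2 = q.1.2 := congrArg Subtype.val hpq
    refine Subtype.ext (Prod.ext (RelIso.ext fun w => ?_) h1)
    obtain ⟨ζ, n, rfl⟩ := exists_eq_factorWord x w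
    rw [hle p.2, hle q.2, h1]

theorem isAmenableGroup_sequenceGroup_of_isCyclic [∀ i, IsCyclic (G i)] :
    IsAmenableGroup (sequenceGroup a) :=
  isAmenableGroup_closure_range
    (fun _ _ => funext fun _ => IsCyclic.isMulCommutative.is_comm.comm _ _) _

end Tree

end SegalType

theorem mainTheorem10
    {X : ℕ → Type*} {G : ℕ → Type*}
    [∀ i, Finite (X i)] [∀ i, Group (G i)] [∀ i, MulAction (G i) (X i)]
    [∀ i, FaithfulSMul (G i) (X i)] [∀ i, MulAction.IsPretransitive (G i) (X i)]
    {k : ℕ} (a : ∀ i, Fin k → G i)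
    (ha : ∀ i, Subgroup.closure (Set.range (a i)) = ⊤)
    (x y : ∀ i, X i) (hxy : ∀ i, x i ≠ y i) :
    (SegalType.IsAmenableGroup (SegalType.segalGroup a x y) ↔
      SegalType.IsAmenableGroup (SegalType.sequenceGroup a)) ∧
    ((∀ i, IsCyclic (G i)) → SegalType.IsAmenableGroup (SegalType.segalGroup a x y)) := by
  have key : SegalType.IsAmenableGroup (SegalType.segalGroup a x y) ↔
      SegalType.IsAmenableGroup (SegalType.sequenceGroup a) :=
    SegalType.isAmenableGroup_segalGroup_iff_boundaryGroup.trans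
      ⟨SegalType.isAmenableGroup_sequenceGroup hxy, SegalType.isAmenableGroup_boundaryGroup⟩
  exact ⟨key, fun _ => key.2 SegalType.isAmenableGroup_sequenceGroup_of_isCyclic⟩
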